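/- **Setting.** A seller prices one product over episodes of $H\ge 1$ periods. Prices lie in $[0,p_{\max}]$, $0\le p_{\max}<\infty$. Let $n\ge 0$, let $\mathcal S=\bigcup_{i=0}^{n}[0,p_{\max}]^i$ (where $i=0$ contributes the empty history), and for $\theta\in\mathbb R^l$ let $f_\theta:[0,p_{\max}]\times\mathcal S\to\mathbb R$ be a function, jointly measurable in $\theta$ and its arguments. In period $h$ of an episode with prices $\mathbf p=(p_1,\dots,p_H)$ the state is $s_h=(p_{\max(1,h-n)},\dots,p_{h-1})$, the demand parameter is $d_h=f_\theta(p_h,s_h)$, and the value of $\mathbf p$ is $V_{\mathbf p}(\theta)=\sum_{h=1}^H p_h f_\theta(p_h,s_h)$. The unknown $\theta$ has prior distribution $\pi$ on $\mathbb R^l$, with support $\Theta$. Let $\mathrm{DP}$ be a measurable map with $\mathrm{DP}(\theta)\in\arg\max_{\mathbf p\in[0,p_{\max}]^H}V_{\mathbf p}(\theta)$ for all $\theta\in\Theta$. Thompson Pricing (TP) samples, at the start of episode $k$ and with fresh randomness, $\hat\theta_k$ from the posterior distribution of $\theta$ given the prices and demands of episodes $1,\dots,k-1$, and uses the prices $\mathbf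 p_k=\mathrm{DP}(\hat\theta_k)$ in episode $k$. Conditionally on $\theta$, $\hat\theta_1,\dots,\hat\theta_k$ and all earlier demands, the demand $y_{k,h}$ is log-normal with parameters $d_{k,h}-\sigma^2/2$ and $\sigma^2$, where $\sigma>0$ and $d_{k,h}$ is the demand parameter of period $h$ under $\theta$ and $\mathbf p_k$. The regret after $K$ episodes is $R_K=\mathbb E\big[\sum_{k=1}^K\big(V_{\mathrm{DP}(\theta)}(\theta)-V_{\mathbf p_k}(\theta)\big)\big]$, the expectation being over $\theta$, the demands and the sampling. **Complexity.** Let $\mathcal F=\{f_\theta:\theta\in\Theta\}$ and $\mathcal X=[0,p_{\max}]\times\mathcal S$. $N(\mathcal F,\alpha)$ is the least number of members of $\mathcal F$ such that every member of $\mathcal F$ is within supremum distance $\alpha$ of one of them, and $d_K(\mathcal F)=\limsup_{\alpha\downarrow0}\log N(\mathcal F,\alpha)/\log(1/\alpha)$. A point $x\in\mathcal X$ is $\epsilon$-independent of $x_1,\dots,x_m$ if there are $g_1,g_2\in\mathcal F$ with $\big(\sum_{j}(g_1(x_j)-g_2(x_j))^2\big)^{1/2}\le\epsilon$ and $g_1(x)-g_2(x)>\epsilon$;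 $d_E(\mathcal F,\epsilon)$ is the length of the longest sequence in $\mathcal X$ for which there is an $\epsilon'\ge\epsilon$ such that each element is $\epsilon'$-independent of its predecessors. These quantities may be $+\infty$. **Theorem.** Suppose that there is $d_{\max}>0$ with $f_\theta(p,s)\in[0,d_{\max}]$ for all $\theta\in\Theta$, $p\in[0,p_{\max}]$, $s\in\mathcal S$. Then the regret is well defined and, for every $K\ge1$, $$R_K\le p_{\max}\Big(1+Hd_{\max}\,d_E(\mathcal F,(KH)^{-2})+4\sqrt{\beta_K\,d_E(\mathcal F,(KH)^{-2})\,KH}\Big)+\frac{4p_{\max}d_{\max}}{KH},$$ where $$\beta_K=8\sigma^2\log\big((KH)^2N(\mathcal F,(KH)^{-2})\big)+\frac{2}{KH}\Big(8d_{\max}+\sqrt{8\sigma^2\log4}\Big).$$ Moreover, if $d_K(\mathcal F)>0$, then, as $K\to\infty$, $$R_K=O\Big(p_{\max}\,\sigma\sqrt{d_K(\mathcal F)\,d_E(\mathcal F,(KH)^{-2})\,KH\log(KH)}\Big).$$ More precisely: for every $\kappa>0$ there is a constant $C$, depending only on $\kappa$, such that in every problem as above with $d_K(\mathcal F)\ge\kappa$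 the inequality $R_K\le C\,p_{\max}\sigma\sqrt{d_K(\mathcal F)\,d_E(\mathcal F,(KH)^{-2})\,KH\log(KH)}$ holds for all sufficiently large $K$ (how large may depend on the problem). Products follow the convention $0\cdot\infty=0$. -/

import Mathlib

open MeasureTheory ProbabilityTheory Filter Topology
open scoped ENNReal NNReal UniformConvergence

noncomputable section

/-! ### Complexity of a class of functions -/

/-- The `α`-covering number of a class `G` of real functions on `X` with respect to the supremum
norm: the least number of members of `G` such that every member of `G` is within sup-distance `α`
of one of them (`⊤` if there is no finite such cover). -/
def supCoveringNumber {X : Type*} (G : Set (X → ℝ)) (α : ℝ) : ℕ∞ :=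
  Metric.coveringNumber α.toNNReal ((UniformFun.ofFun : (X → ℝ) → (X →ᵤ ℝ)) '' G)

/-- `log N(G, α)`, with values in `[0, ∞]` (for a non-empty class, `N(G, α) ≥ 1`). -/
def logCoveringNumber {X : Type*} (G : Set (X → ℝ)) (α : ℝ) : ℝ≥0∞ :=
  (ENNReal.log (supCoveringNumber G α : ℝ≥0∞)).toENNReal

/-- The Kolmogorov dimension `limsup_{α ↓ 0} log N(G, α) / log (1 / α)`. -/
def kolmogorovDim {X : Type*} (G : Set (X → ℝ)) : ℝ≥0∞ :=
  limsup (fun α : ℝ => logCoveringNumber G α / ENNReal.ofReal (Real.log (1 / α))) (𝓝[>] (0 : ℝ))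

/-- `x` is `ε`-dependent on the finite sequence `xs` with respect to `G`. -/
def EpsDependent {X : Type*} (G : Set (X → ℝ)) (ε : ℝ) {m : ℕ} (xs : Fin m → X) (x : X) : Prop :=
  ∀ g₁ ∈ G, ∀ g₂ ∈ G, √(∑ j, (g₁ (xs j) - g₂ (xs j)) ^ 2) ≤ ε → g₁ x - g₂ x ≤ ε

/-- Every element of the sequence `xs` is `ε`-independent of its predecessors. -/
def IsEluderSequence {X : Type*} (G : Set (X → ℝ)) (ε : ℝ) {m : ℕ} (xs : Fin m → X) : Prop :=
  ∀ i : Fin m, ¬ EpsDependent G ε (fun j : Fin i => xs (Fin.castLE i.isLt.le j)) (xs i)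

/-- The `ε`-eluder dimension: the length of the longest sequence of elements of `X` such that, for
some `ε' ≥ ε`, every element is `ε'`-independent of its predecessors (`⊤` if the lengths are
unbounded). -/
def eluderDim {X : Type*} (G : Set (X → ℝ)) (ε : ℝ) : ℕ∞ :=
  sSup {m : ℕ∞ | ∃ (l : ℕ) (xs : Fin l → X) (ε' : ℝ),
    m = l ∧ ε ≤ ε' ∧ IsEluderSequence G ε' xs}

/-! ### Dynamic pricing with reference effects -/

/-- Admissible prices `[0, p_max]`. -/
abbrev Price (pMax : ℝ) : Type := Set.Icc (0 : ℝ) pMax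

/-- Price histories of length at most `n`: the disjoint union of `[0, p_max]^i`, `0 ≤ i ≤ n`. -/
abbrev PriceState (n : ℕ) (pMax : ℝ) : Type := Σ i : Fin (n + 1), (Fin i → Price pMax)

/-- The state in period `h` (periods are numbered from `0`): the last `min h n` prices set before
period `h` of the same episode, in chronological order. -/
def stateAt (n : ℕ) {pMax : ℝ} {H : ℕ} (p : Fin H → Price pMax) (h : Fin H) :
    PriceState n pMax :=
  ⟨⟨min (h : ℕ) n, by omega⟩, fun j =>
    p ⟨(h : ℕ) - min (h : ℕ) n + (j : ℕ), by
      have h1 := j.isLt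
      have h2 := h.isLt
      simp only at h1
      omega⟩⟩

/-- The log-normal law with parameters `m` and `v`: the law of `exp Z` with `Z ∼ N(m, v)`. -/
def logNormal (m : ℝ) (v : ℝ≥0) : Measure ℝ := (gaussianReal m v).map Real.exp

/-- A single-product pricing problem with reference effects and a prior on the unknown
parameter. -/
structure PricingModel where
  /-- dimension of the parameter -/
  l : ℕ
  /-- memory of the demand model -/
  n : ℕ
  /-- number of periods of an episode -/
  H : ℕ
  one_le_H : 1 ≤ H
  /-- maximum price -/
  pMax : ℝ
  pMax_nonneg : 0 ≤ pMax
  /-- demand uncertainty -/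
  σ : ℝ
  σ_pos : 0 < σ
  /-- the demand function `f_θ (p, s)` -/
  f : EuclideanSpace ℝ (Fin l) → Price pMax × PriceState n pMax → ℝ
  measurable_f : Measurable (Function.uncurry f)
  /-- the prior -/
  prior : Measure (EuclideanSpace ℝ (Fin l))
  isProbabilityMeasure_prior : IsProbabilityMeasure prior

namespace PricingModel

variable (M : PricingModel)

/-- The parameter space in which `θ` takes its values. -/
abbrev Param : Type := EuclideanSpace ℝ (Fin M.l)

/-- A price sequence for one episode. -/
abbrev Policy : Type := Fin M.H → Price M.pMax

/-- The class of demand functions `f_θ`, with `θ` in the support of the prior. -/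
def demandClass : Set (Price M.pMax × PriceState M.n M.pMax → ℝ) := M.f '' M.prior.support

/-- Demand functions take values in `[0, d_max]`. -/
def DemandBounded (dMax : ℝ) : Prop :=
  ∀ θ ∈ M.prior.support, ∀ p s, M.f θ (p, s) ∈ Set.Icc (0 : ℝ) dMax

/-- The demand parameter `d_h = f_θ (p_h, s_h)` in period `h` under the price sequence `p`. -/
def demandParam (θ : M.Param) (p : M.Policy) (h : Fin M.H) : ℝ := M.f θ (p h, stateAt M.n p h)

/-- The value `V_p = ∑_h p_h f_θ (p_h, s_h)` of a price sequence. -/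
def value (θ : M.Param) (p : M.Policy) : ℝ := ∑ h, (p h : ℝ) * M.demandParam θ p h

/-- `dp` solves the planning problem: `dp θ` maximizes the value over all price sequences, for
each `θ` in the support of the prior (and `dp` is a measurable choice of a maximizer). -/
structure IsPlanner (dp : M.Param → M.Policy) : Prop where
  measurable : Measurable dp
  optimal : ∀ θ ∈ M.prior.support, ∀ p : M.Policy, M.value θ p ≤ M.value θ (dp θ)

section Dynamics

variable {Ω : Type*} (dp : M.Param → M.Policy) (θ : Ω → M.Param) (θhat : ℕ → Ω → M.Param)
  (y : ℕ → Fin M.H → Ω → ℝ)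

/-- The `σ`-algebra of what the seller has observed before episode `k`: prices and demands of
episodes `0, …, k - 1` (the states are functions of the prices). -/
abbrev history (k : ℕ) : MeasurableSpace Ω :=
  ⨆ (j : ℕ) (_ : j < k) (h : Fin M.H),
    MeasurableSpace.comap (fun ω => (dp (θhat j ω) h, y j h ω)) inferInstance

/-- The `σ`-algebra of everything that is determined before the parameter sample of episode `k` is
drawn: the true parameter, the earlier samples and the earlier demands. -/
abbrev beforeSample (k : ℕ) : MeasurableSpace Ω :=
  MeasurableSpace.comap θ inferInstance ⊔
  (⨆ (j : ℕ) (_ : j < k), MeasurableSpace.comap (θhat j) inferInstance) ⊔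
  (⨆ (j : ℕ) (_ : j < k) (i : Fin M.H), MeasurableSpace.comap (y j i) inferInstance)

/-- The `σ`-algebra of everything that is determined when the price of period `h` of episode `k` is
set: the true parameter, the samples of episodes `0, …, k` (hence the prices of these episodes),
and the demands of all earlier periods. -/
abbrev beforeDemand (k : ℕ) (h : Fin M.H) : MeasurableSpace Ω :=
  MeasurableSpace.comap θ inferInstance ⊔
  (⨆ (j : ℕ) (_ : j ≤ k), MeasurableSpace.comap (θhat j) inferInstance) ⊔
  (⨆ (j : ℕ) (i : Fin M.H) (_ : j < k ∨ (j = k ∧ i < h)),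
    MeasurableSpace.comap (y j i) inferInstance)

/-- The process generated by Thompson Pricing with planner `dp`. Episodes are numbered from `0`;
`θ` is the true parameter, `θhat k` the parameter sampled at the start of episode `k`,
`dp (θhat k)` the price sequence of episode `k`, and `y k h` the demand observed in its period
`h`. -/
structure IsThompsonPricing [MeasurableSpace Ω] (P : Measure Ω) : Prop where
  isProbabilityMeasure : IsProbabilityMeasure P
  measurable_θ : Measurable θ
  measurable_θhat : ∀ k, Measurable (θhat k)
  measurable_y : ∀ k h, Measurable (y k h)
  /-- The true parameter is distributed according to the prior. -/
  law_θ : P.map θ = M.prior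
  /-- Given everything before, `θhat k` is drawn from the posterior of `θ` given the history. -/
  law_θhat : ∀ k, ∀ A : Set M.Param, MeasurableSet A →
    P⟦θhat k ⁻¹' A | M.beforeSample θ θhat y k⟧ =ᵐ[P] P⟦θ ⁻¹' A | M.history dp θhat y k⟧
  /-- Given everything before, `y k h` is log-normal with parameters `d_{k,h} - σ² / 2`, `σ²`. -/
  law_y : ∀ k h, ∀ B : Set ℝ, MeasurableSet B →
    P⟦y k h ⁻¹' B | M.beforeDemand θ θhat y k h⟧ =ᵐ[P] fun ω =>
      (logNormal (M.demandParam (θ ω) (dp (θhat k ω)) h - M.σ ^ 2 / 2) (M.σ ^ 2).toNNReal).real B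

/-- The loss `∑_{k < K} (V_{p*} - V_{p_k})` over the first `K` episodes; its mean is the regret. -/
def loss (K : ℕ) (ω : Ω) : ℝ :=
  ∑ k ∈ Finset.range K,
    (M.value (θ ω) (dp (θ ω)) - M.value (θ ω) (dp (θhat k ω)))

/-- The cumulative regret over the first `K` episodes (expectation over the prior, the demands and
the sampling). -/
def regret [MeasurableSpace Ω] (P : Measure Ω) (K : ℕ) : ℝ := ∫ ω, M.loss dp θ θhat K ω ∂P

end Dynamics

/-- The number `K H` of periods in `K` episodes. -/
def periods (K : ℕ) : ℝ := (K : ℝ) * (M.H : ℝ)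

/-- `d_E(F, (K H)⁻²)`. -/
def eluder (K : ℕ) : ℝ≥0∞ := (eluderDim M.demandClass ((M.periods K ^ 2)⁻¹) : ℝ≥0∞)

/-- `β_K = 8 σ² log((K H)² N(F, (K H)⁻²)) + (2 / (K H)) (8 d_max + √(8 σ² log 4))`. -/
def beta (dMax : ℝ) (K : ℕ) : ℝ≥0∞ :=
  ENNReal.ofReal (8 * M.σ ^ 2) *
      (ENNReal.log (ENNReal.ofReal (M.periods K ^ 2) *
        (supCoveringNumber M.demandClass ((M.periods K ^ 2)⁻¹) : ℝ≥0∞))).toENNReal +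
    ENNReal.ofReal (2 / M.periods K * (8 * dMax + √(8 * M.σ ^ 2 * Real.log 4)))

/-- The explicit regret bound, with values in `[0, ∞]`. -/
def regretBound (dMax : ℝ) (K : ℕ) : ℝ≥0∞ :=
  ENNReal.ofReal M.pMax *
      (1 + M.H * ENNReal.ofReal dMax * M.eluder K +
        4 * (M.beta dMax K * M.eluder K * ENNReal.ofReal (M.periods K)) ^ (1 / 2 : ℝ)) +
    ENNReal.ofReal (4 * M.pMax * dMax / M.periods K)

/-- `p_max σ √(d_K(F) d_E(F, (K H)⁻²) K H log(K H))`, with values in `[0, ∞]`. -/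
def regretRate (K : ℕ) : ℝ≥0∞ :=
  ENNReal.ofReal (M.pMax * M.σ) *
    (kolmogorovDim M.demandClass * M.eluder K *
      ENNReal.ofReal (M.periods K * Real.log (M.periods K))) ^ (1 / 2 : ℝ)

end PricingModel

end

/-!
# Regret of Thompson Pricing with reference effects

Given the history of the earlier episodes, the sample `θ̂` of an episode has the law of the true
parameter `θ` (`IsThompsonPricing.map_sample_eq`). The optimal value therefore has the same mean
under both, and the regret of the episode is the mean of `∑ h, p_h (f_θ̂ - f_θ)(x_h)`, where `p` is
optimal for `θ̂` and `x_h` are the points `(p_h, s_h)` (`IsThompsonPricing.regret_eq`). It remains to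
see that `f_θ̂` and `f_θ` are close on the past, and that functions which are close on the past can
differ much at few new points only.

*Closeness on the past.* Instead of a confidence set around a least squares estimate, the proof
compares `θ` and `θ̂` directly. Let `T = K H` and fix a finite cover of the class at scale
`T⁻²`. For two elements of the cover with difference `b`, the noise `ξ` of the log-demand being
`N(0, σ²)`, the exponential of `∑ (ξ b / (2 σ²) - b² / (8 σ²))` has mean one
(`IsThompsonPricing.lintegral_exp_sum_logTilt`), so with probability at least `1 - T⁻²` these sums
are at most `log (N² T²)` for all pairs; since `(θ̂, history)` has the law of `(θ, history)`, the same
holds with `θ̂` in the place of `θ`. Choosing cover elements near `θ` and near `θ̂`, and adding the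
inequality for `θ` to the one for `θ̂` with the two elements exchanged, the noise cancels, and
`∑ (f_θ̂ - f_θ)² ≤ 8 σ² log (N² T²) + O(d_max / T)` remains (`sum_sq_le_of_notMem_atypical`). Only
fixed pairs of functions enter the events, so no measurability in `θ` of a nearest cover element
is needed.

*Few large deviations.* If the squared distance on earlier episodes is at most `B`, the periods in
which `f_θ̂ - f_θ` exceeds `ε` can be distributed greedily over `⌊B / ε²⌋ + H` sequences in which
every point is `ε`-independent of its predecessors (`exists_coloring`), so that there are at most
`(H + B / ε²) d_E` of them (`card_large_le`). Removing the smallest deviation repeatedly turns these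
counts into the bound `1 + H d_max d_E + 2 √(B d_E T)` for the sum (`sum_le_of_card_le`).

*The rate.* Eventually `log N ≤ 4 d_K log T` by the definition of `d_K`. The term `H d_max d_E`, in
which `d_E` may grow with `T`, is dominated by the rate unless `d_E` exceeds a multiple of
`T log T`, and then the trivial bound `p_max d_max T` is dominated (`min_bound_le_rate`).
-/

/-! ### Eluder sequences and the counting of large deviations -/

section Eluder

variable {X ι : Type*} [LinearOrder ι]

/-- Greedy splitting: if at each index `t ∈ S` the total weight `∑ q t i` of the indices `i` in
earlier blocks is at most `B`, then `S` can be coloured with `L` colours so that the weight carried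
by the predecessors of `t` with the colour of `t` is at most `ε²`. The other indices of the block of
`t` spoil at most `H - 1` colours, and fewer than `L + 1 - H` colours are spoilt by earlier
blocks. -/
theorem exists_coloring {β : Type*} [LinearOrder β] (blk : ι → β) (q : ι → ι → ℝ)
    (hq : ∀ t i, 0 ≤ q t i) {B ε : ℝ} {L H : ℕ}
    (hL : B < ((L : ℝ) + 1 - H) * ε ^ 2)
    (hblk : Monotone blk) (S : Finset ι)
    (hH : ∀ t ∈ S, (S.filter fun i => i < t ∧ blk i = blk t).card < H)
    (hB : ∀ t ∈ S, ∑ i ∈ S with blk i < blk t, q t i ≤ B) :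
    ∃ c : ι → ℕ, ∀ t ∈ S, c t < L ∧ ∑ i ∈ S with i < t ∧ c i = c t, q t i ≤ ε ^ 2 := by
  classical
  induction S using Finset.induction_on_max with
  | empty => exact ⟨fun _ => 0, by simp⟩
  | insert a S ha ih =>
    have haS : a ∉ S := fun h => lt_irrefl _ (ha a h)
    obtain ⟨c, hc⟩ := ih
      (fun t ht => lt_of_le_of_lt (Finset.card_le_card
        (Finset.filter_subset_filter _ (Finset.subset_insert _ _)))
        (hH t (Finset.mem_insert_of_mem ht)))
      (fun t ht => le_trans (Finset.sum_le_sum_of_subset_of_nonneg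
        (Finset.filter_subset_filter _ (Finset.subset_insert _ _)) fun i _ _ => hq t i)
        (hB t (Finset.mem_insert_of_mem ht)))
    -- the maximal index `a` precedes no other index, so any admissible colour will do for it
    obtain ⟨v, hvL, hv⟩ : ∃ v < L, ∑ i ∈ S with c i = v, q a i ≤ ε ^ 2 := by
      by_contra! hcon
      set R : Finset ℕ := (S.filter fun i => blk i = blk a).image c with hR
      have hRcard : R.card < H := by
        refine lt_of_le_of_lt Finset.card_image_le
          (lt_of_le_of_lt (Finset.card_le_card ?_) (hH a (Finset.mem_insert_self _ _)))
        intro i hi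
        simp only [Finset.mem_filter, Finset.mem_insert] at hi ⊢
        exact ⟨Or.inr hi.1, ha i hi.1, hi.2⟩
      set V : Finset ℕ := Finset.range L \ R with hV
      have hVcard : L + 1 ≤ V.card + H := by
        have := Finset.le_card_sdiff R (Finset.range L)
        rw [Finset.card_range, ← hV] at this
        omega
      have hlow : (V.card : ℝ) * ε ^ 2 ≤ ∑ v ∈ V, ∑ i ∈ S with c i = v, q a i := by
        rw [← nsmul_eq_mul]
        refine Finset.card_nsmul_le_sum _ _ _ fun v hv => (hcon v ?_).le
        simpa using (Finset.mem_sdiff.1 hv).1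
      have hup : ∑ v ∈ V, ∑ i ∈ S with c i = v, q a i ≤ B := by
        rw [Finset.sum_fiberwise_eq_sum_filter]
        refine le_trans (Finset.sum_le_sum_of_subset_of_nonneg ?_ fun i _ _ => hq a i)
          (hB a (Finset.mem_insert_self _ _))
        intro i hi
        simp only [Finset.mem_filter, Finset.mem_insert] at hi ⊢
        refine ⟨Or.inr hi.1, lt_of_le_of_ne (hblk (ha i hi.1).le) fun h => ?_⟩
        exact (Finset.mem_sdiff.1 hi.2).2
          (Finset.mem_image_of_mem c (Finset.mem_filter.2 ⟨hi.1, h⟩))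
      have h1 : (L : ℝ) + 1 - H ≤ V.card := by
        have : ((L + 1 : ℕ) : ℝ) ≤ ((V.card + H : ℕ) : ℝ) := by exact_mod_cast hVcard
        push_cast at this
        linarith
      have h2 := mul_le_mul_of_nonneg_right h1 (sq_nonneg ε)
      linarith
    refine ⟨Function.update c a v, fun t ht => ?_⟩
    rcases Finset.mem_insert.1 ht with rfl | ht
    · refine ⟨by simpa using hvL, ?_⟩
      refine le_trans (Finset.sum_le_sum_of_subset_of_nonneg ?_ fun i _ _ => hq t i) hv
      intro i hi
      simp only [Finset.mem_filter, Finset.mem_insert, Function.update_self] at hi ⊢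
      obtain ⟨hi, hlt, hci⟩ := hi
      rw [Function.update_of_ne hlt.ne] at hci
      exact ⟨hi.resolve_left hlt.ne, hci⟩
    · have hta : t ≠ a := (ha t ht).ne
      rw [Function.update_of_ne hta]
      refine ⟨(hc t ht).1, le_trans (Finset.sum_le_sum_of_subset_of_nonneg ?_
        fun i _ _ => hq t i) (hc t ht).2⟩
      intro i hi
      simp only [Finset.mem_filter, Finset.mem_insert] at hi ⊢
      obtain ⟨hi, hlt, hci⟩ := hi
      have hia : i ≠ a := (hlt.trans (ha t ht)).ne
      rw [Function.update_of_ne hia] at hci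
      exact ⟨hi.resolve_left hia, hlt, hci⟩

/-- A finite set of indices at each of which some pair of functions of `G` witnesses
`ε`-independence of the preceding points has at most `d_E(G, ε₀)` elements, for `ε₀ ≤ ε`. -/
theorem card_le_eluderDim {G : Set (X → ℝ)} (x : ι → X) (S : Finset ι) {ε₀ ε : ℝ}
    (h0 : ε₀ ≤ ε) (hε : 0 ≤ ε)
    (hS : ∀ t ∈ S, ∃ g₁ ∈ G, ∃ g₂ ∈ G,
      ∑ i ∈ S with i < t, (g₁ (x i) - g₂ (x i)) ^ 2 ≤ ε ^ 2 ∧ ε < g₁ (x t) - g₂ (x t)) :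
    (S.card : ℕ∞) ≤ eluderDim G ε₀ := by
  classical
  set e := S.orderEmbOfFin rfl with he
  refine le_sSup ⟨S.card, fun j => x (e j), ε, rfl, h0, fun j hdep => ?_⟩
  obtain ⟨g₁, hg₁, g₂, hg₂, hsum, hlt⟩ := hS (e j) (S.orderEmbOfFin_mem rfl j)
  refine absurd (hdep g₁ hg₁ g₂ hg₂ ?_) (not_le.2 hlt)
  refine Real.sqrt_le_iff.2 ⟨hε, le_trans ?_ hsum⟩
  have hinj : Function.Injective fun k : Fin j => e (Fin.castLE j.isLt.le k) :=
    fun a b hab => Fin.castLE_injective _ (e.injective hab)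
  rw [← Finset.sum_image (s := Finset.univ) (g := fun k : Fin j => e (Fin.castLE j.isLt.le k))
    (f := fun i => (g₁ (x i) - g₂ (x i)) ^ 2) hinj.injOn]
  refine Finset.sum_le_sum_of_subset_of_nonneg ?_ fun i _ _ => sq_nonneg _
  intro i hi
  obtain ⟨k, -, rfl⟩ := Finset.mem_image.1 hi
  refine Finset.mem_filter.2 ⟨S.orderEmbOfFin_mem rfl _, e.strictMono ?_⟩
  exact Fin.lt_def.2 k.isLt

/-- The number of indices at which `g₁ t - g₂ t` exceeds `ε` at the point `x t`, when the squared
distance of `g₁ t` and `g₂ t` on the earlier blocks is at most `B`, is at most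
`(H + B / ε²) d_E(G, ε₀)`. -/
theorem card_large_le {β : Type*} [LinearOrder β] {G : Set (X → ℝ)} (x : ι → X) (blk : ι → β)
    (hblk : Monotone blk) {H d : ℕ} {B ε₀ ε : ℝ} (hB0 : 0 ≤ B) (hd : eluderDim G ε₀ ≤ d)
    (h0 : ε₀ ≤ ε) (hε : 0 < ε) (g₁ g₂ : ι → X → ℝ) (S : Finset ι)
    (hG₁ : ∀ t ∈ S, g₁ t ∈ G) (hG₂ : ∀ t ∈ S, g₂ t ∈ G)
    (hH : ∀ t ∈ S, (S.filter fun i => i < t ∧ blk i = blk t).card < H)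
    (hB : ∀ t ∈ S, ∑ i ∈ S with blk i < blk t, (g₁ t (x i) - g₂ t (x i)) ^ 2 ≤ B)
    (hlarge : ∀ t ∈ S, ε < g₁ t (x t) - g₂ t (x t)) :
    (S.card : ℝ) ≤ (H * d : ℕ) + B * d / ε ^ 2 := by
  classical
  set L : ℕ := ⌊B / ε ^ 2⌋₊ + H with hLdef
  have hε2 : 0 < ε ^ 2 := by positivity
  have hL : B < ((L : ℝ) + 1 - H) * ε ^ 2 := by
    have := Nat.lt_floor_add_one (B / ε ^ 2)
    rw [div_lt_iff₀ hε2] at this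
    rw [hLdef]; push_cast
    linarith
  obtain ⟨c, hc⟩ := exists_coloring blk (fun t i => (g₁ t (x i) - g₂ t (x i)) ^ 2)
    (fun _ _ => sq_nonneg _) (L := L) hL hblk S hH hB
  have hclass : ∀ v, (S.filter fun i => c i = v).card ≤ d := by
    intro v
    have := card_le_eluderDim (G := G) x (S.filter fun i => c i = v) h0 hε.le (fun t ht => by
      obtain ⟨htS, htv⟩ := Finset.mem_filter.1 ht
      refine ⟨g₁ t, hG₁ t htS, g₂ t, hG₂ t htS, ?_, hlarge t htS⟩
      refine le_trans (le_of_eq ?_) (hc t htS).2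
      rw [Finset.filter_filter, htv]
      simp only [and_comm])
    exact_mod_cast this.trans hd
  have hcard : S.card ≤ L * d := by
    rw [Finset.card_eq_sum_card_fiberwise (f := c) (t := Finset.range L)
      (fun t ht => by simpa using (hc t ht).1)]
    calc _ ≤ ∑ _v ∈ Finset.range L, d := Finset.sum_le_sum fun v _ => hclass v
      _ = L * d := by simp
  have hfl : (⌊B / ε ^ 2⌋₊ : ℝ) ≤ B / ε ^ 2 := Nat.floor_le (by positivity)
  calc (S.card : ℝ) ≤ ((L * d : ℕ) : ℝ) := by exact_mod_cast hcard
    _ = (H * d : ℕ) + ⌊B / ε ^ 2⌋₊ * d := by rw [hLdef]; push_cast; ring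
    _ ≤ (H * d : ℕ) + B / ε ^ 2 * d := by gcongr
    _ = _ := by ring

/-- Summation of a counting bound: if at most `A + Q / ε²` of the numbers `w t ∈ [0, C]` exceed
`ε`, for each `ε ≥ ε₀`, then they sum to at most `n ε₀ + A C + 2 √(Q (n - A))`. The elements are removed
in increasing order: the smallest of `n > A` numbers is at most `ε₀` or at most `√(Q / (n - A))`. -/
theorem sum_le_of_card_le {ι : Type*} {A : ℕ} {Q C ε₀ : ℝ} (hQ : 0 ≤ Q) (hC : 0 ≤ C)
    (hε₀ : 0 < ε₀) (w : ι → ℝ) (S : Finset ι) (hwC : ∀ t ∈ S, w t ≤ C)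
    (hcard : ∀ S' ⊆ S, ∀ ε, ε₀ ≤ ε → (∀ t ∈ S', ε < w t) → (S'.card : ℝ) ≤ A + Q / ε ^ 2) :
    ∑ t ∈ S, w t ≤ S.card * ε₀ + A * C + 2 * (√Q * √((S.card - A : ℕ) : ℝ)) := by
  classical
  induction hn : S.card generalizing S with
  | zero =>
    rw [Finset.card_eq_zero.1 hn]
    simp; positivity
  | succ n ih =>
    by_cases hnA : n + 1 ≤ A
    · calc ∑ t ∈ S, w t ≤ ∑ _t ∈ S, C := Finset.sum_le_sum hwC
        _ = ((n + 1 : ℕ) : ℝ) * C := by rw [Finset.sum_const, hn, nsmul_eq_mul]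
        _ ≤ A * C := by gcongr
        _ ≤ _ := by
          have : (0 : ℝ) ≤ ((n + 1 : ℕ) : ℝ) * ε₀ := by positivity
          have : (0 : ℝ) ≤ 2 * (√Q * √(((n + 1 - A : ℕ)) : ℝ)) := by positivity
          linarith
    · push Not at hnA
      have hne : S.Nonempty := Finset.card_pos.1 (by omega)
      obtain ⟨m, hm, hmin⟩ := S.exists_min_image w hne
      have hsub : S.erase m ⊆ S := Finset.erase_subset _ _
      have hrec := ih (S.erase m) (fun t ht => hwC t (hsub ht))
        (fun S' hS' => hcard S' (hS'.trans hsub)) (by rw [Finset.card_erase_of_mem hm]; omega)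
      rw [← Finset.add_sum_erase S w hm]
      set s : ℕ := n - A with hs
      have hs1 : n + 1 - A = s + 1 := by omega
      rw [hs1]
      -- otherwise all `A + s + 1` elements would exceed the right-hand side `ε`, which is at least
      -- `ε₀` and satisfies `Q / ε² < s + 1`
      have hwm : w m ≤ ε₀ + √Q / √((s : ℝ) + 1) := by
        by_contra! hlt
        have hr : 0 ≤ √Q / √((s : ℝ) + 1) := by positivity
        have hb := hcard S subset_rfl (ε₀ + √Q / √((s : ℝ) + 1)) (by linarith)
          (fun t ht => hlt.trans_le (hmin t ht))
        have hn' : (S.card : ℝ) = A + ((s : ℝ) + 1) := by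
          rw [hn]; exact_mod_cast (by omega : n + 1 = A + (s + 1))
        rw [hn'] at hb
        have h1 : (s : ℝ) + 1 ≤ Q / (ε₀ + √Q / √((s : ℝ) + 1)) ^ 2 := by linarith
        rw [le_div_iff₀ (by positivity)] at h1
        have h2 : ((s : ℝ) + 1) * (√Q / √((s : ℝ) + 1)) ^ 2 = Q := by
          rw [div_pow, Real.sq_sqrt hQ, Real.sq_sqrt (by positivity)]
          field_simp
        have h3 : (√Q / √((s : ℝ) + 1)) ^ 2 < (ε₀ + √Q / √((s : ℝ) + 1)) ^ 2 := by
          gcongr; linarith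
        have h4 : (0 : ℝ) < (s : ℝ) + 1 := by positivity
        nlinarith
      have hsq : √(s : ℝ) + 1 / (2 * √((s : ℝ) + 1)) ≤ √((s : ℝ) + 1) := by
        have ha := Real.sqrt_nonneg (s : ℝ)
        have hb : 0 < √((s : ℝ) + 1) := Real.sqrt_pos.2 (by positivity)
        have ha2 := Real.sq_sqrt (Nat.cast_nonneg (α := ℝ) s)
        have hb2 := Real.sq_sqrt (show (0 : ℝ) ≤ (s : ℝ) + 1 by positivity)
        have : 1 / (2 * √((s : ℝ) + 1)) * √((s : ℝ) + 1) = 1 / 2 := by field_simp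
        by_contra! hcon
        nlinarith [sq_nonneg (√((s : ℝ) + 1) - √(s : ℝ))]
      have hq := mul_le_mul_of_nonneg_left hsq (Real.sqrt_nonneg Q)
      have he : √Q / √((s : ℝ) + 1) = 2 * (√Q * (1 / (2 * √((s : ℝ) + 1)))) := by field_simp
      rw [he] at hwm
      push_cast
      linarith


/-- Total excess over episodes of `H` periods, when the pair `(g₁ k, g₂ k)` compared in episode `k`
has squared distance at most `B` on the earlier episodes. -/
theorem sum_excess_le {X : Type*} {G : Set (X → ℝ)} {K H d : ℕ} {B C ε₀ : ℝ} (hB0 : 0 ≤ B)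
    (hC : 0 ≤ C) (hε₀ : 0 < ε₀) (hd : eluderDim G ε₀ ≤ d) (x : ℕ → Fin H → X)
    (g₁ g₂ : ℕ → X → ℝ) (good : Finset ℕ) (hgood : good ⊆ Finset.range K)
    (hG₁ : ∀ k ∈ good, g₁ k ∈ G) (hG₂ : ∀ k ∈ good, g₂ k ∈ G)
    (hB : ∀ k ∈ good, ∑ j ∈ Finset.range k, ∑ h, (g₁ k (x j h) - g₂ k (x j h)) ^ 2 ≤ B)
    (hwC : ∀ k ∈ good, ∀ h, g₁ k (x k h) - g₂ k (x k h) ≤ C) :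
    ∑ k ∈ good, ∑ h, max (g₁ k (x k h) - g₂ k (x k h)) 0 ≤
      K * H * ε₀ + H * d * C + 2 * (√(B * d) * √((K : ℝ) * H)) := by
  classical
  set S : Finset (ℕ ×ₗ Fin H) := (good ×ˢ Finset.univ).map toLex.toEmbedding with hS
  have hmem : ∀ t : ℕ ×ₗ Fin H, t ∈ S ↔ (ofLex t).1 ∈ good := by
    intro t
    rw [hS, Finset.mem_map]
    constructor
    · rintro ⟨a, ha, rfl⟩
      exact (Finset.mem_product.1 ha).1
    · exact fun h => ⟨ofLex t, Finset.mem_product.2 ⟨h, Finset.mem_univ _⟩, rfl⟩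
  have hSle : S.card ≤ K * H := by
    rw [hS, Finset.card_map, Finset.card_product, Finset.card_univ, Fintype.card_fin]
    exact Nat.mul_le_mul_right _ (by simpa using Finset.card_le_card hgood)
  have key := sum_le_of_card_le (A := H * d) (Q := B * d) (C := C) (ε₀ := ε₀) (by positivity) hC
    hε₀ (fun t : ℕ ×ₗ Fin H => max (g₁ (ofLex t).1 (x (ofLex t).1 (ofLex t).2)
      - g₂ (ofLex t).1 (x (ofLex t).1 (ofLex t).2)) 0) S
    (fun t ht => max_le (hwC _ ((hmem t).1 ht) _) hC) (by
      intro S' hS' ε hε hlarge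
      refine card_large_le (G := G) (fun t : ℕ ×ₗ Fin H => x (ofLex t).1 (ofLex t).2)
        (fun t => (ofLex t).1) Prod.Lex.monotone_fst_ofLex hB0 hd hε (hε₀.trans_le hε)
        (fun t => g₁ (ofLex t).1) (fun t => g₂ (ofLex t).1) S'
        (fun t ht => hG₁ _ ((hmem t).1 (hS' ht))) (fun t ht => hG₂ _ ((hmem t).1 (hS' ht)))
        ?_ ?_ (fun t ht =>
          (lt_max_iff.1 (hlarge t ht)).resolve_right (not_lt.2 (hε₀.le.trans hε)))
      · intro t _
        calc _ ≤ ((Finset.univ.erase (ofLex t).2).image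
              fun h => toLex ((ofLex t).1, h)).card := by
              refine Finset.card_le_card fun i hi => ?_
              obtain ⟨-, hlt, hblk⟩ := Finset.mem_filter.1 hi
              refine Finset.mem_image.2 ⟨(ofLex i).2, Finset.mem_erase.2 ⟨fun h => hlt.ne ?_,
                Finset.mem_univ _⟩, ?_⟩
              · exact congrArg toLex (Prod.ext hblk h)
              · rw [← hblk]; rfl
          _ ≤ (Finset.univ.erase (ofLex t).2).card := Finset.card_image_le
          _ < (Finset.univ : Finset (Fin H)).card :=
              Finset.card_erase_lt_of_mem (Finset.mem_univ _)
          _ = H := by simp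
      · intro t ht
        refine le_trans ?_ (hB _ ((hmem t).1 (hS' ht)))
        rw [← Finset.sum_product']
        refine le_trans ?_ (le_of_eq (Finset.sum_map (Finset.range (ofLex t).1 ×ˢ Finset.univ)
          (toLex.toEmbedding : ℕ × Fin H ↪ ℕ ×ₗ Fin H) (fun i =>
            (g₁ (ofLex t).1 (x (ofLex i).1 (ofLex i).2)
              - g₂ (ofLex t).1 (x (ofLex i).1 (ofLex i).2)) ^ 2)))
        refine Finset.sum_le_sum_of_subset_of_nonneg (fun i hi => ?_) fun i _ _ => sq_nonneg _
        exact Finset.mem_map.2 ⟨ofLex i, Finset.mem_product.2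
          ⟨Finset.mem_range.2 (Finset.mem_filter.1 hi).2, Finset.mem_univ _⟩, rfl⟩)
  have hsum : ∑ k ∈ good, ∑ h, max (g₁ k (x k h) - g₂ k (x k h)) 0 =
      ∑ t ∈ S, max (g₁ (ofLex t).1 (x (ofLex t).1 (ofLex t).2)
        - g₂ (ofLex t).1 (x (ofLex t).1 (ofLex t).2)) 0 := by
    rw [hS, Finset.sum_map, ← Finset.sum_product']
    rfl
  rw [hsum]
  refine key.trans ?_
  have h1 : (S.card : ℝ) ≤ K * H := by exact_mod_cast hSle
  have h2 : ((S.card - H * d : ℕ) : ℝ) ≤ K * H := by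
    exact_mod_cast (Nat.sub_le _ _).trans hSle
  push_cast
  gcongr

end Eluder

/-! ### Covering numbers -/

section Covering

variable {X : Type*} {G : Set (X → ℝ)}

theorem exists_cover_of_supCoveringNumber_eq {α : ℝ} (hα : 0 ≤ α) {N : ℕ}
    (hN : supCoveringNumber G α = N) :
    ∃ c : Fin N → (X → ℝ), (∀ i, c i ∈ G) ∧ ∀ g ∈ G, ∃ i, ∀ x, |g x - c i x| ≤ α := by
  obtain ⟨C, hC, hCfin, hcover, hcard⟩ := Metric.exists_set_encard_eq_coveringNumber
    (ε := α.toNNReal) (A := (UniformFun.ofFun : (X → ℝ) → (X →ᵤ ℝ)) '' G)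
    (by rw [← supCoveringNumber, hN]; exact ENat.natCast_ne_top N)
  rw [← supCoveringNumber, hN] at hcard
  have hcard' : C.ncard = N := by rw [Set.ncard, hcard]; rfl
  have : Finite C := hCfin
  let e : C ≃ Fin N := Finite.equivFinOfCardEq (by rw [← hcard']; rfl)
  refine ⟨fun i => UniformFun.toFun (e.symm i : X →ᵤ ℝ), fun i => ?_, fun g hg => ?_⟩
  · obtain ⟨g, hg, hgi⟩ := hC (e.symm i).2
    have : UniformFun.toFun (e.symm i : X →ᵤ ℝ) = g := by rw [← hgi]; rfl
    exact (congrArg (· ∈ G) this).mpr hg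
  · obtain ⟨u, hu, hdist⟩ := hcover (Set.mem_image_of_mem _ hg)
    refine ⟨e ⟨u, hu⟩, fun x => ?_⟩
    have h := UniformFun.edist_le.1 hdist x
    rw [edist_dist, ENNReal.ofReal_le_iff_le_toReal (by simp), Real.dist_eq] at h
    simpa [Real.coe_toNNReal _ hα] using h

theorem supCoveringNumber_ne_zero {α : ℝ} (hG : G.Nonempty) : supCoveringNumber G α ≠ 0 := by
  rw [supCoveringNumber, Ne, Metric.coveringNumber_eq_zero]
  exact (hG.image _).ne_empty

theorem supCoveringNumber_anti {α β : ℝ} (h : α ≤ β) :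
    supCoveringNumber G β ≤ supCoveringNumber G α :=
  Metric.coveringNumber_anti (Real.toNNReal_le_toNNReal h)

/-- If no single point is independent, all functions of the class are within `α` of each other. -/
theorem supCoveringNumber_le_one_of_eluderDim_eq_zero {α : ℝ} (hα : 0 ≤ α)
    (h : eluderDim G α = 0) : supCoveringNumber G α ≤ 1 := by
  refine Metric.coveringNumber_le_one_of_ediam_le (Metric.ediam_le ?_)
  have hle : ∀ g₁ ∈ G, ∀ g₂ ∈ G, ∀ x, g₁ x - g₂ x ≤ α := by
    intro g₁ h₁ g₂ h₂ x
    by_contra! hlt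
    have h1 : (1 : ℕ∞) ≤ eluderDim G α := by
      refine le_sSup ⟨1, fun _ => x, α, rfl, le_rfl, fun i hdep => ?_⟩
      refine absurd (hdep g₁ h₁ g₂ h₂ ?_) (not_le.2 hlt)
      have : i = 0 := Subsingleton.elim _ _
      subst this
      simpa using hα
    rw [h] at h1
    exact absurd h1 (by simp)
  rintro _ ⟨g₁, h₁, rfl⟩ _ ⟨g₂, h₂, rfl⟩
  refine UniformFun.edist_le.2 fun x => ?_
  rw [edist_dist, Real.dist_eq]
  exact ENNReal.ofReal_le_ofReal
    (abs_le.2 ⟨by have := hle g₂ h₂ g₁ h₁ x; simp; linarith, by simpa using hle g₁ h₁ g₂ h₂ x⟩)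

end Covering

/-! ### Exponential moments of log-normal observations -/

section LogNormal

variable {Ω : Type*} {m m0 : MeasurableSpace Ω} {P : Measure Ω} [IsProbabilityMeasure P]
  {y δ : Ω → ℝ} {s : ℝ}

theorem measure_inter_preimage_of_condExp (hm : m ≤ m0) (hy : Measurable y) {v : ℝ≥0}
    (hlaw : ∀ B : Set ℝ, MeasurableSet B →
      P⟦y ⁻¹' B | m⟧ =ᵐ[P] fun ω => (logNormal (δ ω) v).real B)
    {A : Set Ω} (hA : MeasurableSet[m] A) {B : Set ℝ} (hB : MeasurableSet B) :
    P (A ∩ y ⁻¹' B) = ∫⁻ ω in A, logNormal (δ ω) v B ∂P := by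
  have hyB : MeasurableSet[m0] (y ⁻¹' B) := hy hB
  have hprob : ∀ ω, IsProbabilityMeasure (logNormal (δ ω) v) := fun ω =>
    Measure.isProbabilityMeasure_map (by fun_prop)
  have hint : Integrable (fun ω => (logNormal (δ ω) v).real B) P :=
    integrable_condExp.congr (hlaw B hB)
  have h1 : ∫ ω in A, (logNormal (δ ω) v).real B ∂P = P.real (A ∩ y ⁻¹' B) := by
    rw [← setIntegral_congr_ae (hm A hA) ((hlaw B hB).mono fun ω h _ => h),
      setIntegral_condExp hm ((integrable_const (1 : ℝ)).indicator hyB) hA,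
      setIntegral_indicator hyB]
    simp
  have h2 := ofReal_integral_eq_lintegral_ofReal hint.integrableOn
    (ae_of_all (P.restrict A) fun ω => (measureReal_nonneg : 0 ≤ (logNormal (δ ω) v).real B))
  rw [h1, ofReal_measureReal] at h2
  rw [h2]
  refine lintegral_congr fun ω => ?_
  exact ofReal_measureReal

theorem logNormal_apply_eq (d : ℝ) (v : ℝ≥0) {B : Set ℝ} (hB : MeasurableSet B) :
    logNormal d v B = gaussianReal 0 v ((fun z => Real.exp (d + z)) ⁻¹' B) := by
  rw [logNormal, ← zero_add d, ← gaussianReal_map_const_add, Measure.map_map (by fun_prop)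
    (by fun_prop), Measure.map_apply (by fun_prop) hB, zero_add]
  rfl

/-- Disintegration: jointly with an `m`-measurable variable `U`, an observation `y` that is
log-normal given `m` is distributed as `exp (δ + z)`, with `z` an independent Gaussian. -/
theorem map_prodMk_of_condExp_logNormal (hm : m ≤ m0) (hy : Measurable y) {v : ℝ≥0}
    {E : Type*} [MeasurableSpace E] {U : Ω → E} (hU : Measurable[m] U) {d : E → ℝ}
    (hd : Measurable d)
    (hlaw : ∀ B : Set ℝ, MeasurableSet B →
      P⟦y ⁻¹' B | m⟧ =ᵐ[P] fun ω => (logNormal (d (U ω)) v).real B) :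
    P.map (fun ω => (U ω, y ω)) =
      ((P.map U).prod (gaussianReal 0 v)).map fun p => (p.1, Real.exp (d p.1 + p.2)) := by
  have hU0 : Measurable U := hU.mono hm le_rfl
  have : IsProbabilityMeasure (P.map U) := Measure.isProbabilityMeasure_map hU0.aemeasurable
  have hΦ : Measurable fun p : E × ℝ => (p.1, Real.exp (d p.1 + p.2)) := by fun_prop
  refine Measure.ext_prod fun {s t} hs ht => ?_
  rw [Measure.map_apply (hU0.prodMk hy) (hs.prod ht), Measure.map_apply hΦ (hs.prod ht),
    Measure.prod_apply (hΦ (hs.prod ht))]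
  have hset : (fun ω => (U ω, y ω)) ⁻¹' s ×ˢ t = U ⁻¹' s ∩ y ⁻¹' t := rfl
  rw [hset, measure_inter_preimage_of_condExp hm hy hlaw (hU hs) ht,
    ← lintegral_indicator (hU0 hs), lintegral_map (measurable_measure_prodMk_left
      (hΦ (hs.prod ht))) hU0]
  refine lintegral_congr fun ω => ?_
  by_cases hω : U ω ∈ s
  · rw [Set.indicator_of_mem (show ω ∈ U ⁻¹' s from hω),
      logNormal_apply_eq _ _ ht]
    congr 1
    ext z
    simp [hω]
  · rw [Set.indicator_of_notMem (show ω ∉ U ⁻¹' s from hω)]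
    have : Prod.mk (U ω) ⁻¹' ((fun p : E × ℝ => (p.1, Real.exp (d p.1 + p.2))) ⁻¹' s ×ˢ t) = ∅ := by
      ext z
      simp [hω]
    rw [this, measure_empty]

theorem lintegral_exp_gaussianReal (hs : 0 < s) (a : ℝ) :
    ∫⁻ z, ENNReal.ofReal (Real.exp (z * a / (2 * s ^ 2) - a ^ 2 / (8 * s ^ 2)))
      ∂(gaussianReal 0 (s ^ 2).toNNReal) = 1 := by
  have hmgf := mgf_gaussianReal (p := gaussianReal 0 (s ^ 2).toNNReal) (X := id)
    (Measure.map_id) (a / (2 * s ^ 2))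
  have hint : Integrable (fun z : ℝ => Real.exp (a / (2 * s ^ 2) * z))
      (gaussianReal 0 (s ^ 2).toNNReal) := integrable_exp_mul_gaussianReal _
  have heq : (fun z : ℝ => Real.exp (z * a / (2 * s ^ 2) - a ^ 2 / (8 * s ^ 2))) =
      fun z => Real.exp (-(a ^ 2 / (8 * s ^ 2))) * Real.exp (a / (2 * s ^ 2) * z) := by
    funext z
    rw [← Real.exp_add]
    ring_nf
  rw [← ofReal_integral_eq_lintegral_ofReal (by rw [heq]; exact hint.const_mul _)
    (ae_of_all _ fun z => (Real.exp_pos _).le), heq, integral_const_mul]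
  rw [mgf] at hmgf
  simp only [id] at hmgf
  rw [hmgf, ← Real.exp_add, Real.coe_toNNReal _ (sq_nonneg s)]
  rw [show -(a ^ 2 / (8 * s ^ 2)) + (0 * (a / (2 * s ^ 2)) + s ^ 2 * (a / (2 * s ^ 2)) ^ 2 / 2) = 0
    by field_simp; ring]
  simp

/-- One step of the exponential martingale: the centred logarithm of an observation is Gaussian with
variance `s²`, so the tilt `exp (ξ a / (2 s²) - a² / (8 s²))` has conditional mean one. -/
theorem lintegral_mul_exp_of_condExp_logNormal (hm : m ≤ m0) (hy : Measurable y)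
    (hδ : Measurable[m] δ) (hs : 0 < s)
    (hlaw : ∀ B : Set ℝ, MeasurableSet B → P⟦y ⁻¹' B | m⟧ =ᵐ[P] fun ω =>
      (logNormal (δ ω - s ^ 2 / 2) (s ^ 2).toNNReal).real B)
    {W : Ω → ℝ≥0∞} (hW : Measurable[m] W) {a : Ω → ℝ} (ha : Measurable[m] a) :
    ∫⁻ ω, W ω * ENNReal.ofReal (Real.exp
      ((Real.log (y ω) + s ^ 2 / 2 - δ ω) * a ω / (2 * s ^ 2) - a ω ^ 2 / (8 * s ^ 2))) ∂P =
    ∫⁻ ω, W ω ∂P := by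
  let U : Ω → ℝ≥0∞ × ℝ × ℝ := fun ω => (W ω, a ω, δ ω)
  have hU : Measurable[m] U := hW.prodMk (ha.prodMk hδ)
  have hU0 : Measurable U := hU.mono hm le_rfl
  have : IsProbabilityMeasure (P.map U) := Measure.isProbabilityMeasure_map hU0.aemeasurable
  let F : (ℝ≥0∞ × ℝ × ℝ) × ℝ → ℝ≥0∞ := fun p => p.1.1 * ENNReal.ofReal (Real.exp
    ((Real.log p.2 + s ^ 2 / 2 - p.1.2.2) * p.1.2.1 / (2 * s ^ 2) - p.1.2.1 ^ 2 / (8 * s ^ 2)))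
  have hF : Measurable F := by fun_prop
  have hd : Measurable fun u : ℝ≥0∞ × ℝ × ℝ => u.2.2 - s ^ 2 / 2 := by fun_prop
  have hmap := map_prodMk_of_condExp_logNormal hm hy hU hd hlaw
  calc _ = ∫⁻ ω, F (U ω, y ω) ∂P := rfl
    _ = ∫⁻ p, F p ∂(P.map fun ω => (U ω, y ω)) := (lintegral_map hF (hU0.prodMk hy)).symm
    _ = ∫⁻ p, F (p.1, Real.exp (p.1.2.2 - s ^ 2 / 2 + p.2))
          ∂((P.map U).prod (gaussianReal 0 (s ^ 2).toNNReal)) := by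
        rw [hmap, lintegral_map hF (by fun_prop)]
    _ = ∫⁻ u, ∫⁻ z, F (u, Real.exp (u.2.2 - s ^ 2 / 2 + z))
          ∂(gaussianReal 0 (s ^ 2).toNNReal) ∂(P.map U) :=
        lintegral_prod _ (by fun_prop)
    _ = ∫⁻ u, u.1 ∂(P.map U) := by
        refine lintegral_congr fun u => ?_
        have h := lintegral_exp_gaussianReal hs u.2.1
        calc _ = ∫⁻ z, u.1 * ENNReal.ofReal (Real.exp (z * u.2.1 / (2 * s ^ 2)
              - u.2.1 ^ 2 / (8 * s ^ 2))) ∂(gaussianReal 0 (s ^ 2).toNNReal) := by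
              refine lintegral_congr fun z => ?_
              simp only [F, Real.log_exp]
              congr 4
              ring
          _ = u.1 := by rw [lintegral_const_mul _ (by fun_prop), h, mul_one]
    _ = ∫⁻ ω, W ω ∂P := lintegral_map measurable_fst hU0

end LogNormal

/-! ### The likelihood tilt of a pricing problem -/

namespace PricingModel

variable (M : PricingModel)

theorem measurable_stateAt (h : Fin M.H) :
    Measurable fun p : M.Policy => stateAt M.n p h := by
  have hmk : ∀ i : Fin (M.n + 1),
      Measurable (Sigma.mk (β := fun i : Fin (M.n + 1) => Fin i → Price M.pMax) i) := by
    intro i s hs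
    exact (MeasurableSpace.measurableSet_iInf.1 hs) i
  exact (hmk _).comp (measurable_pi_lambda _ fun j => measurable_pi_apply _)

theorem measurable_demandParam (h : Fin M.H) :
    Measurable fun z : M.Param × M.Policy => M.demandParam z.1 z.2 h := by
  have h1 : Measurable fun z : M.Param × M.Policy => (z.1, (z.2 h, stateAt M.n z.2 h)) :=
    measurable_fst.prodMk (((measurable_pi_apply h).comp measurable_snd).prodMk
      ((M.measurable_stateAt h).comp measurable_snd))
  exact M.measurable_f.comp h1

theorem measurable_value : Measurable fun z : M.Param × M.Policy => M.value z.1 z.2 :=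
  Finset.measurable_sum _ fun h _ =>
    (measurable_subtype_coe.comp ((measurable_pi_apply h).comp measurable_snd)).mul
      (M.measurable_demandParam h)

/-- Prices and demands of one episode. -/
abbrev Episode : Type := M.Policy × (Fin M.H → ℝ)

/-- The logarithm of the factor contributed by period `h` to the exponential martingale that
compares the demand functions of `θ₁` and `θ₂` when the true parameter is `θ`: with `ξ` the noise
of the log-demand and `b` the difference of the two demand parameters, it is
`ξ b / (2 σ²) - b² / (8 σ²)`. -/
noncomputable def logTilt (θ₁ θ₂ θ : M.Param) (e : M.Episode) (h : Fin M.H) : ℝ :=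
  (Real.log (e.2 h) + M.σ ^ 2 / 2 - M.demandParam θ e.1 h) *
      (M.demandParam θ₁ e.1 h - M.demandParam θ₂ e.1 h) / (2 * M.σ ^ 2) -
    (M.demandParam θ₁ e.1 h - M.demandParam θ₂ e.1 h) ^ 2 / (8 * M.σ ^ 2)

theorem measurable_demandParam_comp {Z : Type*} [MeasurableSpace Z] {u : Z → M.Param}
    {p : Z → M.Policy} (hu : Measurable u) (hp : Measurable p) (h : Fin M.H) :
    Measurable fun z => M.demandParam (u z) (p z) h :=
  (M.measurable_demandParam h).comp (hu.prodMk hp)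

theorem measurable_logTilt {Z : Type*} [MeasurableSpace Z] (θ₁ θ₂ : M.Param) {u : Z → M.Param}
    {p : Z → M.Policy} {d : Z → Fin M.H → ℝ} (hu : Measurable u) (hp : Measurable p) (h : Fin M.H)
    (hd : Measurable fun z => d z h) :
    Measurable fun z => M.logTilt θ₁ θ₂ (u z) (p z, d z) h := by
  have h1 := M.measurable_demandParam_comp hu hp h
  have h2 := M.measurable_demandParam_comp (measurable_const (a := θ₁)) hp h
  have h3 := M.measurable_demandParam_comp (measurable_const (a := θ₂)) hp h
  unfold logTilt
  dsimp only
  fun_prop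

/-- The event that the exponential martingale of some pair of the parameters `c` reaches the level
`exp L` at the parameter `z.1` and the past `z.2`. -/
def atypical {N : ℕ} (c : Fin N → M.Param) (L : ℝ) (k : ℕ) :
    Set (M.Param × (Fin k → M.Episode)) :=
  {z | ∃ i j, L ≤ ∑ n, ∑ h, M.logTilt (c i) (c j) z.1 (z.2 n) h}

theorem measurableSet_atypical {N : ℕ} (c : Fin N → M.Param) (L : ℝ) (k : ℕ) :
    MeasurableSet (M.atypical c L k) := by
  simp only [atypical, Set.ofPred_exists]
  refine MeasurableSet.iUnion fun i => MeasurableSet.iUnion fun j =>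
    measurableSet_le measurable_const ?_
  refine Finset.measurable_sum _ fun n _ => Finset.measurable_sum _ fun h _ => ?_
  exact M.measurable_logTilt (c i) (c j) (u := fun z : M.Param × (Fin k → M.Episode) => z.1)
    (p := fun z => (z.2 n).1) (d := fun z => (z.2 n).2) (by fun_prop) (by fun_prop) h
    (by fun_prop)

/-- If the past `e` is typical both for `θ₁` and for `θ₂`, their demand functions are close on it.
With `z` the log-demand plus `σ² / 2` and `b` the difference of the demand functions of cover
elements near `θ₂` and `θ₁`, typicality for `θ₁` bounds `2 ∑ (z - f_θ₁) b - ∑ b² / 2` and typicality for `θ₂` bounds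
`2 ∑ (z - f_θ₂) (-b) - ∑ b² / 2`; the noise cancels in the sum of the two. -/
theorem sum_sq_le_of_notMem_atypical {dMax : ℝ} (hbd : M.DemandBounded dMax) {N : ℕ}
    {c : Fin N → M.Param} {α L : ℝ}
    (hc : ∀ θ ∈ M.prior.support, ∃ i, ∀ x, |M.f θ x - M.f (c i) x| ≤ α)
    {k : ℕ} {θ₁ θ₂ : M.Param} (h₁ : θ₁ ∈ M.prior.support) (h₂ : θ₂ ∈ M.prior.support)
    {e : Fin k → M.Episode} (ha₁ : (θ₁, e) ∉ M.atypical c L k)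
    (ha₂ : (θ₂, e) ∉ M.atypical c L k) (hcs : ∀ i, c i ∈ M.prior.support) (hα : 0 ≤ α) :
    ∑ n, ∑ h, (M.demandParam θ₂ (e n).1 h - M.demandParam θ₁ (e n).1 h) ^ 2 ≤
      8 * M.σ ^ 2 * L + 4 * α * dMax * (k * M.H) := by
  obtain ⟨i, hi⟩ := hc θ₁ h₁
  obtain ⟨j, hj⟩ := hc θ₂ h₂
  have hσ := M.σ_pos
  simp only [atypical, Set.mem_ofPred_eq, not_exists, not_le] at ha₁ ha₂
  have hsum := add_lt_add (ha₁ j i) (ha₂ i j)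
  rw [← Finset.sum_add_distrib] at hsum
  have hpt : ∀ n h, (M.demandParam θ₂ (e n).1 h - M.demandParam θ₁ (e n).1 h) ^ 2 ≤
      4 * M.σ ^ 2 * (M.logTilt (c j) (c i) θ₁ (e n) h + M.logTilt (c i) (c j) θ₂ (e n) h)
        + 4 * α * dMax := by
    intro n h
    have e1 := hi ((e n).1 h, stateAt M.n (e n).1 h)
    have e2 := hj ((e n).1 h, stateAt M.n (e n).1 h)
    have b1 := hbd _ h₁ ((e n).1 h) (stateAt M.n (e n).1 h)
    have b2 := hbd _ h₂ ((e n).1 h) (stateAt M.n (e n).1 h)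
    have b3 := hbd _ (hcs i) ((e n).1 h) (stateAt M.n (e n).1 h)
    have b4 := hbd _ (hcs j) ((e n).1 h) (stateAt M.n (e n).1 h)
    simp only [logTilt, demandParam]
    generalize M.f θ₁ ((e n).1 h, stateAt M.n (e n).1 h) = f₁ at *
    generalize M.f θ₂ ((e n).1 h, stateAt M.n (e n).1 h) = f₂ at *
    generalize M.f (c i) ((e n).1 h, stateAt M.n (e n).1 h) = ci at *
    generalize M.f (c j) ((e n).1 h, stateAt M.n (e n).1 h) = cj at *
    have hexp : 4 * M.σ ^ 2 * ((Real.log ((e n).2 h) + M.σ ^ 2 / 2 - f₁) * (cj - ci)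
          / (2 * M.σ ^ 2) - (cj - ci) ^ 2 / (8 * M.σ ^ 2) +
        ((Real.log ((e n).2 h) + M.σ ^ 2 / 2 - f₂) * (ci - cj)
          / (2 * M.σ ^ 2) - (ci - cj) ^ 2 / (8 * M.σ ^ 2))) =
        2 * (f₂ - f₁) * (cj - ci) - (cj - ci) ^ 2 := by
      field_simp
      ring
    rw [hexp]
    -- the remainder is the square of `r`, where `|r| ≤ 2 α` and `|r| ≤ 2 dMax`
    set r := f₂ - f₁ - (cj - ci) with hr
    have hr1 : |r| ≤ 2 * α := by
      rw [hr, show f₂ - f₁ - (cj - ci) = (f₂ - cj) - (f₁ - ci) by ring]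
      exact (abs_sub _ _).trans (by linarith)
    have hr2 : |r| ≤ 2 * dMax := by
      rw [abs_le]
      constructor <;> linarith [b1.1, b1.2, b2.1, b2.2, b3.1, b3.2, b4.1, b4.2]
    have hr3 : r ^ 2 ≤ 4 * α * dMax := by
      rw [← sq_abs]
      nlinarith [abs_nonneg r]
    have : (f₂ - f₁) ^ 2 = 2 * (f₂ - f₁) * (cj - ci) - (cj - ci) ^ 2 + r ^ 2 := by
      rw [hr]; ring
    linarith
  calc _ ≤ ∑ n, ∑ h, (4 * M.σ ^ 2 * (M.logTilt (c j) (c i) θ₁ (e n) h +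
        M.logTilt (c i) (c j) θ₂ (e n) h) + 4 * α * dMax) :=
        Finset.sum_le_sum fun n _ => Finset.sum_le_sum fun h _ => hpt n h
    _ = 4 * M.σ ^ 2 * (∑ n, (∑ h, M.logTilt (c j) (c i) θ₁ (e n) h +
          ∑ h, M.logTilt (c i) (c j) θ₂ (e n) h)) + 4 * α * dMax * (k * M.H) := by
        simp only [Finset.sum_add_distrib, ← Finset.mul_sum, Finset.sum_const, Finset.card_univ,
          Fintype.card_fin, nsmul_eq_mul]
        ring
    _ ≤ 4 * M.σ ^ 2 * (L + L) + 4 * α * dMax * (k * M.H) := by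
        gcongr
    _ = _ := by ring

/-! ### The exponential martingale and posterior sampling -/

theorem measurable_sum_logTilt {Z : Type*} [MeasurableSpace Z] (θ₁ θ₂ : M.Param) {u : Z → M.Param}
    {p : ℕ → Z → M.Policy} {d : ℕ → Fin M.H → Z → ℝ} (hu : Measurable u) (k : ℕ)
    (s : Finset (Fin M.H)) (hp : ∀ j ≤ k, Measurable (p j))
    (hd : ∀ j i, j < k ∨ (j = k ∧ i ∈ s) → Measurable (d j i)) :
    Measurable fun z =>
      ∑ j ∈ Finset.range k, ∑ h, M.logTilt θ₁ θ₂ (u z) (p j z, fun i => d j i z) h +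
      ∑ h ∈ s, M.logTilt θ₁ θ₂ (u z) (p k z, fun i => d k i z) h := by
  refine (Finset.measurable_sum _ fun j hj => Finset.measurable_sum _ fun h _ => ?_).add
    (Finset.measurable_sum _ fun h hh => ?_)
  · have hj := Finset.mem_range.1 hj
    exact M.measurable_logTilt θ₁ θ₂ hu (hp j hj.le) h (hd j h (Or.inl hj))
  · exact M.measurable_logTilt θ₁ θ₂ hu (hp k le_rfl) h (hd k h (Or.inr ⟨rfl, hh⟩))

namespace IsThompsonPricing

variable {M} {Ω : Type*} {dp : M.Param → M.Policy} {θ : Ω → M.Param} {θhat : ℕ → Ω → M.Param}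
  {y : ℕ → Fin M.H → Ω → ℝ}

theorem history_le_beforeSample (hdp : Measurable dp) (k : ℕ) :
    M.history dp θhat y k ≤ M.beforeSample θ θhat y k := by
  refine iSup_le fun j => iSup_le fun hj => iSup_le fun h => ?_
  have h1 : Measurable[M.beforeSample θ θhat y k] (θhat j) :=
    (comap_measurable (θhat j)).mono
      ((le_iSup₂_of_le (f := fun j (_ : j < k) =>
        MeasurableSpace.comap (θhat j) inferInstance) j hj le_rfl).trans (le_sup_right.trans le_sup_left)) le_rfl
  have h2 : Measurable[M.beforeSample θ θhat y k] (y j h) :=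
    (comap_measurable (y j h)).mono
      (le_trans (le_iSup₂_of_le (f := fun j (_ : j < k) => ⨆ i : Fin M.H,
        MeasurableSpace.comap (y j i) inferInstance) j hj
        (le_iSup (fun i => MeasurableSpace.comap (y j i) inferInstance) h)) le_sup_right) le_rfl
  exact (((measurable_pi_apply h).comp (hdp.comp h1)).prodMk h2).comap_le

theorem measurable_history_pi (k : ℕ) :
    Measurable[M.history dp θhat y k]
      fun ω => fun n : Fin k => ((dp (θhat n ω), fun h => y n h ω) : M.Episode) := by
  let _ : MeasurableSpace Ω := M.history dp θhat y k
  have hpair : ∀ (n : Fin k) (h : Fin M.H),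
      Measurable fun ω => (dp (θhat n ω) h, y n h ω) := fun n h =>
    (comap_measurable fun ω => (dp (θhat n ω) h, y n h ω)).mono
      (le_iSup₂_of_le (f := fun j (_ : j < k) => ⨆ h : Fin M.H,
        MeasurableSpace.comap (fun ω => (dp (θhat j ω) h, y j h ω)) inferInstance) (n : ℕ) n.2
        (le_iSup (fun h => MeasurableSpace.comap (fun ω => (dp (θhat n ω) h, y n h ω))
          inferInstance) h)) le_rfl
  refine measurable_pi_lambda _ fun n => Measurable.prodMk (measurable_pi_lambda _ fun h => ?_)
    (measurable_pi_lambda _ fun h => ?_)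
  · exact measurable_fst.comp (hpair n h)
  · exact measurable_snd.comp (hpair n h)

variable [m0 : MeasurableSpace Ω] {P : Measure Ω}

theorem beforeDemand_le (hTP : M.IsThompsonPricing dp θ θhat y P) (k : ℕ) (h : Fin M.H) :
    M.beforeDemand θ θhat y k h ≤ m0 :=
  sup_le (sup_le hTP.measurable_θ.comap_le
    (iSup₂_le fun j _ => (hTP.measurable_θhat j).comap_le))
    (iSup_le fun j => iSup₂_le fun i _ => (hTP.measurable_y j i).comap_le)

theorem beforeSample_le (hTP : M.IsThompsonPricing dp θ θhat y P) (k : ℕ) :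
    M.beforeSample θ θhat y k ≤ m0 :=
  sup_le (sup_le hTP.measurable_θ.comap_le
    (iSup₂_le fun j _ => (hTP.measurable_θhat j).comap_le))
    (iSup_le fun j => iSup₂_le fun _ i => (hTP.measurable_y j i).comap_le)

/-- The exponential martingale that compares two demand functions has mean one: it is extended
period by period with `lintegral_mul_exp_of_condExp_logNormal`. -/
theorem lintegral_exp_sum_logTilt (hTP : M.IsThompsonPricing dp θ θhat y P) (hdp : Measurable dp)
    (θ₁ θ₂ : M.Param) (k : ℕ) :
    ∫⁻ ω, ENNReal.ofReal (Real.exp (∑ j ∈ Finset.range k, ∑ h,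
      M.logTilt θ₁ θ₂ (θ ω) (dp (θhat j ω), fun i => y j i ω) h)) ∂P = 1 := by
  have := hTP.isProbabilityMeasure
  induction k with
  | zero => simp
  | succ k ih =>
    -- the same for the first `m` periods of episode `k`
    have hinner : ∀ m ≤ M.H, ∫⁻ ω, ENNReal.ofReal (Real.exp (∑ j ∈ Finset.range k, ∑ h,
        M.logTilt θ₁ θ₂ (θ ω) (dp (θhat j ω), fun i => y j i ω) h +
        ∑ h ∈ Finset.univ.filter fun i : Fin M.H => (i : ℕ) < m, M.logTilt θ₁ θ₂ (θ ω) (dp (θhat k ω), fun i => y k i ω) h)) ∂P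
        = 1 := by
      intro m
      induction m with
      | zero => intro _; simpa using ih
      | succ m ihm =>
        intro hm
        set h : Fin M.H := ⟨m, hm⟩ with hh
        have hfil : (Finset.univ.filter fun i : Fin M.H => (i : ℕ) < m + 1) =
            insert h (Finset.univ.filter fun i : Fin M.H => (i : ℕ) < m) := by
          ext i
          simp [Fin.ext_iff, hh]
          omega
        have hnot : h ∉ Finset.univ.filter fun i : Fin M.H => (i : ℕ) < m := by simp [hh]
        have hθ : Measurable[M.beforeDemand θ θhat y k h] θ :=
          (comap_measurable θ).mono (le_sup_left.trans le_sup_left) le_rfl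
        have hθhat : ∀ j ≤ k, Measurable[M.beforeDemand θ θhat y k h] fun ω => dp (θhat j ω) :=
          fun j hj => hdp.comp ((comap_measurable (θhat j)).mono
            ((le_iSup₂_of_le (f := fun j (_ : j ≤ k) => MeasurableSpace.comap (θhat j) inferInstance)
              j hj le_rfl).trans (le_sup_right.trans le_sup_left)) le_rfl)
        have hy : ∀ j i, j < k ∨ (j = k ∧ i ∈ Finset.univ.filter fun i : Fin M.H => (i : ℕ) < m) →
            Measurable[M.beforeDemand θ θhat y k h] (y j i) := fun j i hji =>
          (comap_measurable (y j i)).mono (le_trans (le_iSup_of_le j (le_iSup₂_of_le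
            (f := fun (i : Fin M.H) (_ : j < k ∨ (j = k ∧ i < h)) =>
              MeasurableSpace.comap (y j i) inferInstance) i
            (hji.imp_right fun hi => ⟨hi.1, show (i : ℕ) < m by simpa using hi.2⟩) le_rfl))
            le_sup_right) le_rfl
        have hW := @measurable_sum_logTilt M Ω (M.beforeDemand θ θhat y k h) θ₁ θ₂ θ
          (fun j ω => dp (θhat j ω)) y hθ k _ hθhat hy
        have hδ := @measurable_demandParam_comp M Ω (M.beforeDemand θ θhat y k h) _ _ hθ
          (hθhat k le_rfl) h
        have hd : ∀ θ' : M.Param, Measurable[M.beforeDemand θ θhat y k h] fun ω =>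
            M.demandParam θ' (dp (θhat k ω)) h := fun θ' =>
          @measurable_demandParam_comp M Ω (M.beforeDemand θ θhat y k h) _ _
            (@measurable_const _ _ _ (M.beforeDemand θ θhat y k h) θ') (hθhat k le_rfl) h
        have hstep := lintegral_mul_exp_of_condExp_logNormal (hTP.beforeDemand_le k h)
          (hTP.measurable_y k h) hδ M.σ_pos (hTP.law_y k h)
          (ENNReal.measurable_ofReal.comp (Real.measurable_exp.comp hW)) ((hd θ₁).sub (hd θ₂))
        rw [← ihm (by omega)]
        refine Eq.trans (lintegral_congr fun ω => ?_) hstep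
        rw [hfil, Finset.sum_insert hnot, Function.comp_apply, Function.comp_apply,
          ← ENNReal.ofReal_mul (Real.exp_pos _).le, ← Real.exp_add]
        congr 2
        simp only [logTilt, Pi.sub_apply]
        ring
    rw [← hinner M.H le_rfl]
    refine lintegral_congr fun ω => ?_
    rw [Finset.sum_range_succ, Finset.filter_true_of_mem fun i _ => i.2]

/-- The observed past is atypical for the true parameter with probability at most `N² exp (-L)`. -/
theorem measure_atypical_le (hTP : M.IsThompsonPricing dp θ θhat y P) (hdp : Measurable dp)
    {N : ℕ} (c : Fin N → M.Param) (L : ℝ) (k : ℕ) :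
    P {ω | (θ ω, fun n : Fin k => ((dp (θhat n ω), fun h => y n h ω) : M.Episode)) ∈
      M.atypical c L k} ≤ N ^ 2 * ENNReal.ofReal (Real.exp (-L)) := by
  have hpair : ∀ i j, P {ω | L ≤ ∑ n ∈ Finset.range k, ∑ h, M.logTilt (c i) (c j) (θ ω)
      (dp (θhat n ω), fun i => y n i ω) h} ≤ ENNReal.ofReal (Real.exp (-L)) := by
    intro i j
    have hmeas : Measurable fun ω => ∑ n ∈ Finset.range k, ∑ h, M.logTilt (c i) (c j) (θ ω)
        (dp (θhat n ω), fun i => y n i ω) h := by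
      refine Finset.measurable_sum _ fun n _ => Finset.measurable_sum _ fun h _ => ?_
      exact M.measurable_logTilt _ _ hTP.measurable_θ (hdp.comp (hTP.measurable_θhat n)) h
        (hTP.measurable_y n h)
    have hmk := mul_meas_ge_le_lintegral
      (ENNReal.measurable_ofReal.comp (Real.measurable_exp.comp hmeas))
      (ENNReal.ofReal (Real.exp L)) (μ := P)
    simp only [Function.comp_apply, hTP.lintegral_exp_sum_logTilt hdp] at hmk
    rw [mul_comm, ← ENNReal.le_div_iff_mul_le (Or.inl (by simp [Real.exp_pos]))
      (Or.inl ENNReal.ofReal_ne_top), one_div, ← ENNReal.ofReal_inv_of_pos (Real.exp_pos _),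
      ← Real.exp_neg] at hmk
    refine (measure_mono fun ω hω => ?_).trans hmk
    exact ENNReal.ofReal_le_ofReal (Real.exp_le_exp.2 hω)
  have hsub : {ω | (θ ω, fun n : Fin k => ((dp (θhat n ω), fun h => y n h ω) : M.Episode)) ∈
      M.atypical c L k} ⊆ ⋃ i, ⋃ j, {ω | L ≤ ∑ n ∈ Finset.range k, ∑ h,
        M.logTilt (c i) (c j) (θ ω) (dp (θhat n ω), fun i => y n i ω) h} := by
    rintro ω ⟨i, j, hij⟩
    refine Set.mem_iUnion₂.2 ⟨i, j, ?_⟩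
    rw [Set.mem_ofPred_eq, Finset.sum_range]
    exact hij
  calc _ ≤ _ := measure_mono hsub
    _ ≤ ∑ i, ∑ j, P {ω | L ≤ ∑ n ∈ Finset.range k, ∑ h, M.logTilt (c i) (c j) (θ ω)
        (dp (θhat n ω), fun i => y n i ω) h} :=
      (measure_iUnion_fintype_le _ _).trans
        (Finset.sum_le_sum fun i _ => measure_iUnion_fintype_le _ _)
    _ ≤ ∑ _i : Fin N, ∑ _j : Fin N, ENNReal.ofReal (Real.exp (-L)) :=
      Finset.sum_le_sum fun i _ => Finset.sum_le_sum fun j _ => hpair i j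
    _ = _ := by
      simp only [Finset.sum_const, Finset.card_univ, Fintype.card_fin, nsmul_eq_mul]
      ring

/-- Posterior sampling: jointly with any function of the history, the sampled parameter has the
distribution of the true one. -/
theorem map_sample_eq (hTP : M.IsThompsonPricing dp θ θhat y P) (hdp : Measurable dp) (k : ℕ)
    {E : Type*} [MeasurableSpace E] {Q : Ω → E} (hQ : Measurable[M.history dp θhat y k] Q) :
    P.map (fun ω => (θhat k ω, Q ω)) = P.map (fun ω => (θ ω, Q ω)) := by
  have := hTP.isProbabilityMeasure
  have hle1 : M.history dp θhat y k ≤ M.beforeSample θ θhat y k := history_le_beforeSample hdp k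
  have hle2 : M.beforeSample θ θhat y k ≤ m0 := hTP.beforeSample_le k
  have hQ0 : Measurable Q := hQ.mono (hle1.trans hle2) le_rfl
  have hcond : ∀ {m : MeasurableSpace Ω} (_ : m ≤ m0) {S C : Set Ω}, MeasurableSet[m0] S →
      MeasurableSet[m] C → ∫ ω in C, (P⟦S | m⟧) ω ∂P = P.real (C ∩ S) := by
    intro m hm S C hS hC
    rw [setIntegral_condExp hm ((integrable_const (1 : ℝ)).indicator hS) hC,
      setIntegral_indicator hS]
    simp
  have h1 : Measurable fun ω => (θhat k ω, Q ω) := (hTP.measurable_θhat k).prodMk hQ0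
  have h2 : Measurable fun ω => (θ ω, Q ω) := hTP.measurable_θ.prodMk hQ0
  have := Measure.isProbabilityMeasure_map (μ := P) h1.aemeasurable
  refine Measure.ext_prod fun {A B} hA hB => ?_
  rw [Measure.map_apply h1 (hA.prod hB), Measure.map_apply h2 (hA.prod hB)]
  have hr : P.real (Q ⁻¹' B ∩ θhat k ⁻¹' A) = P.real (Q ⁻¹' B ∩ θ ⁻¹' A) := by
    rw [← hcond hle2 (hTP.measurable_θhat k hA) (hle1 _ (hQ hB)),
      ← hcond (hle1.trans hle2) (hTP.measurable_θ hA) (hQ hB)]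
    exact setIntegral_congr_ae (hQ0 hB) ((hTP.law_θhat k A hA).mono fun ω h _ => h)
  have hr' := (ENNReal.toReal_eq_toReal_iff' (measure_ne_top P _) (measure_ne_top P _)).1 hr
  rwa [Set.inter_comm, Set.inter_comm (Q ⁻¹' B)] at hr'

end IsThompsonPricing

/-! ### The finite-time regret bound -/

theorem value_mem_Icc {dMax : ℝ} (hbd : M.DemandBounded dMax) {θ : M.Param}
    (hθ : θ ∈ M.prior.support) (p : M.Policy) :
    M.value θ p ∈ Set.Icc 0 (M.H * (M.pMax * dMax)) := by
  have hb : ∀ h, M.demandParam θ p h ∈ Set.Icc 0 dMax := fun h => hbd θ hθ _ _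
  refine ⟨Finset.sum_nonneg fun h _ => mul_nonneg (p h).2.1 (hb h).1, ?_⟩
  calc M.value θ p ≤ ∑ _h : Fin M.H, M.pMax * dMax :=
        Finset.sum_le_sum fun h _ => mul_le_mul (p h).2.2 (hb h).2 (hb h).1 M.pMax_nonneg
    _ = _ := by simp

theorem one_le_periods {K : ℕ} (hK : 1 ≤ K) : 1 ≤ M.periods K := by
  have := M.one_le_H
  rw [periods]
  exact_mod_cast Nat.one_le_iff_ne_zero.2 (by positivity)

/-- The excess value of `p` under `θ₂` over that under `θ₁`, in terms of the demand functions. -/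
theorem value_sub_value_le (θ₁ θ₂ : M.Param) (p : M.Policy) :
    M.value θ₂ p - M.value θ₁ p ≤
      M.pMax * ∑ h, max (M.demandParam θ₂ p h - M.demandParam θ₁ p h) 0 := by
  rw [value, value, ← Finset.sum_sub_distrib, Finset.mul_sum]
  refine Finset.sum_le_sum fun h _ => ?_
  rw [← mul_sub]
  exact (mul_le_mul_of_nonneg_left (le_max_left _ _) (p h).2.1).trans
    (mul_le_mul_of_nonneg_right (p h).2.2 (le_max_right _ _))

namespace IsThompsonPricing

variable {M} {Ω : Type*} [MeasurableSpace Ω] {P : Measure Ω} {dp : M.Param → M.Policy}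
  {θ : Ω → M.Param} {θhat : ℕ → Ω → M.Param} {y : ℕ → Fin M.H → Ω → ℝ} {dMax : ℝ}

theorem law_sample (hTP : M.IsThompsonPricing dp θ θhat y P) (hdp : Measurable dp) (k : ℕ) :
    P.map (θhat k) = M.prior := by
  have h := hTP.map_sample_eq hdp k (Q := fun _ : Ω => ()) measurable_const
  have h' := congrArg (Measure.map Prod.fst) h
  rw [Measure.map_map measurable_fst ((hTP.measurable_θhat k).prodMk measurable_const),
    Measure.map_map measurable_fst (hTP.measurable_θ.prodMk measurable_const)] at h'
  exact h'.trans hTP.law_θ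

theorem ae_mem_support {u : Ω → M.Param} (hu : Measurable u) (hlaw : P.map u = M.prior) :
    ∀ᵐ ω ∂P, u ω ∈ M.prior.support := by
  have h : M.prior.support ∈ ae M.prior := Measure.support_mem_ae
  rw [← hlaw] at h ⊢
  exact ae_of_ae_map hu.aemeasurable h

/-- The value of a random policy under a random parameter with law the prior is integrable. -/
theorem integrable_value (hTP : M.IsThompsonPricing dp θ θhat y P) (hbd : M.DemandBounded dMax)
    {u : Ω → M.Param} {p : Ω → M.Policy} (hu : Measurable u) (hp : Measurable p)
    (hlaw : P.map u = M.prior) : Integrable (fun ω => M.value (u ω) (p ω)) P := by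
  have := hTP.isProbabilityMeasure
  refine Integrable.of_bound (M.measurable_value.comp (hu.prodMk hp)).aestronglyMeasurable
    (M.H * (M.pMax * dMax)) ?_
  filter_upwards [ae_mem_support hu hlaw] with ω hω
  have := M.value_mem_Icc hbd hω (p ω)
  rw [Real.norm_eq_abs, abs_of_nonneg this.1]
  exact this.2

theorem integrable_loss (hTP : M.IsThompsonPricing dp θ θhat y P) (hdp : Measurable dp)
    (hbd : M.DemandBounded dMax) (K : ℕ) : Integrable (M.loss dp θ θhat K) P :=
  integrable_finsetSum _ fun k _ =>
    (hTP.integrable_value hbd hTP.measurable_θ (hdp.comp hTP.measurable_θ) hTP.law_θ).sub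
      (hTP.integrable_value hbd hTP.measurable_θ (hdp.comp (hTP.measurable_θhat k)) hTP.law_θ)

/-- The true parameter and the sample have the same law, hence so do the values of their optimal
policies, and the regret compares the values of the policy used under the sampled and under the
true parameter. -/
theorem regret_eq (hTP : M.IsThompsonPricing dp θ θhat y P) (hdp : Measurable dp)
    (hbd : M.DemandBounded dMax) (K : ℕ) :
    M.regret dp θ θhat P K = ∫ ω, ∑ k ∈ Finset.range K,
      (M.value (θhat k ω) (dp (θhat k ω)) - M.value (θ ω) (dp (θhat k ω))) ∂P := by
  have i1 := hTP.integrable_value hbd hTP.measurable_θ (hdp.comp hTP.measurable_θ) hTP.law_θ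
  have i2 := fun k => hTP.integrable_value hbd hTP.measurable_θ (hdp.comp (hTP.measurable_θhat k))
    hTP.law_θ
  have i3 := fun k => hTP.integrable_value hbd (hTP.measurable_θhat k)
    (hdp.comp (hTP.measurable_θhat k)) (hTP.law_sample hdp k)
  simp only [Function.comp_apply] at i1 i2 i3
  simp only [regret, loss]
  refine (integral_finsetSum _ fun k _ => i1.sub (i2 k)).trans
    (Eq.trans ?_ (integral_finsetSum _ fun k _ => (i3 k).sub (i2 k)).symm)
  refine Finset.sum_congr rfl fun k _ => ?_
  have hm : Measurable fun u : M.Param => M.value u (dp u) :=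
    M.measurable_value.comp (measurable_id.prodMk hdp)
  refine (integral_sub i1 (i2 k)).trans (Eq.trans ?_ (integral_sub (i3 k) (i2 k)).symm)
  congr 1
  rw [← integral_map (f := fun u => M.value u (dp u)) hTP.measurable_θ.aemeasurable
      hm.aestronglyMeasurable,
    ← integral_map (f := fun u => M.value u (dp u)) (hTP.measurable_θhat k).aemeasurable
      hm.aestronglyMeasurable, hTP.law_θ, hTP.law_sample hdp k]

/-- No policy loses more than `p_max d_max` in a period. -/
theorem regret_le_trivial (hTP : M.IsThompsonPricing dp θ θhat y P) (hdp : Measurable dp)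
    (hbd : M.DemandBounded dMax) (K : ℕ) :
    M.regret dp θ θhat P K ≤ M.pMax * dMax * M.periods K := by
  have := hTP.isProbabilityMeasure
  have hle : ∀ᵐ ω ∂P, M.loss dp θ θhat K ω ≤ M.pMax * dMax * M.periods K := by
    filter_upwards [ae_mem_support hTP.measurable_θ hTP.law_θ] with ω hω
    calc M.loss dp θ θhat K ω ≤ ∑ _k ∈ Finset.range K, M.H * (M.pMax * dMax) :=
          Finset.sum_le_sum fun k _ => by
            linarith [(M.value_mem_Icc hbd hω (dp (θ ω))).2,
              (M.value_mem_Icc hbd hω (dp (θhat k ω))).1]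
      _ = _ := by
          rw [Finset.sum_const, Finset.card_range, nsmul_eq_mul, periods]
          ring
  calc M.regret dp θ θhat P K ≤ ∫ _ω, M.pMax * dMax * M.periods K ∂P :=
        integral_mono_ae (hTP.integrable_loss hdp hbd K) (integrable_const _) hle
    _ = _ := by simp

/-- The regret bound for finite complexities, with `B` the bound for the squared distance of the
sampled and the true demand functions on the past. The samples and the true parameter are typical
with probability at least
`1 - (K H)⁻²` each. -/
theorem regret_le (hTP : M.IsThompsonPricing dp θ θhat y P) (hdp : Measurable dp)
    (hbd : M.DemandBounded dMax) (hdMax : 0 < dMax) {K : ℕ} (hK : 1 ≤ K) {N d : ℕ} (hN0 : N ≠ 0)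
    (hN : supCoveringNumber M.demandClass ((M.periods K ^ 2)⁻¹) = N)
    (hd : eluderDim M.demandClass ((M.periods K ^ 2)⁻¹) ≤ d) {B : ℝ}
    (hB : 8 * M.σ ^ 2 * Real.log (N ^ 2 * M.periods K ^ 2) + 4 * dMax / M.periods K ≤ B) :
    M.regret dp θ θhat P K ≤
      M.pMax * (1 + M.H * d * dMax + 2 * (√(B * d) * √(M.periods K))) +
        2 * M.pMax * dMax / M.periods K := by
  classical
  have := hTP.isProbabilityMeasure
  have hT := M.one_le_periods hK
  set T := M.periods K with hTdef
  have hT0 : 0 < T := by linarith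
  have hε₀ : 0 < (T ^ 2)⁻¹ := by positivity
  have hN1 : (1 : ℝ) ≤ N := by exact_mod_cast Nat.one_le_iff_ne_zero.2 hN0
  set L := Real.log (N ^ 2 * T ^ 2) with hL
  have hL0 : 0 ≤ L := Real.log_nonneg
    (one_le_mul_of_one_le_of_one_le (one_le_pow₀ hN1) (one_le_pow₀ hT))
  have hB0 : 0 ≤ B := le_trans (by positivity) hB
  obtain ⟨g, hgG, hgc⟩ := exists_cover_of_supCoveringNumber_eq hε₀.le hN
  choose c hcs hcg using hgG
  have hc : ∀ θ ∈ M.prior.support, ∃ i, ∀ x, |M.f θ x - M.f (c i) x| ≤ (T ^ 2)⁻¹ := by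
    intro θ hθ
    obtain ⟨i, hi⟩ := hgc _ ⟨θ, hθ, rfl⟩
    exact ⟨i, fun x => by rw [hcg]; exact hi x⟩
  let past : ∀ k : ℕ, Ω → (Fin k → M.Episode) := fun k ω n =>
    (dp (θhat n ω), fun h => y n h ω)
  let bad : ℕ → Set Ω := fun k => {ω | (θ ω, past k ω) ∈ M.atypical c L k} ∪
    {ω | (θhat k ω, past k ω) ∈ M.atypical c L k}
  have hpast : ∀ k, Measurable (past k) := fun k => (measurable_history_pi k).mono
    ((history_le_beforeSample (θ := θ) hdp k).trans (hTP.beforeSample_le k)) le_rfl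
  have hm1 : ∀ k, Measurable fun ω => (θ ω, past k ω) := fun k =>
    hTP.measurable_θ.prodMk (hpast k)
  have hm2 : ∀ k, Measurable fun ω => (θhat k ω, past k ω) := fun k =>
    (hTP.measurable_θhat k).prodMk (hpast k)
  have hbadmeas : ∀ k, MeasurableSet (bad k) := fun k =>
    (hm1 k (M.measurableSet_atypical c L k)).union (hm2 k (M.measurableSet_atypical c L k))
  have hbadP : ∀ k, P.real (bad k) ≤ 2 * (T ^ 2)⁻¹ := by
    intro k
    have e1 : P {ω | (θ ω, past k ω) ∈ M.atypical c L k} ≤ ENNReal.ofReal ((T ^ 2)⁻¹) := by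
      refine (hTP.measure_atypical_le hdp c L k).trans (le_of_eq ?_)
      rw [hL, Real.exp_neg, Real.exp_log (by positivity), ← ENNReal.ofReal_natCast,
        ← ENNReal.ofReal_pow (by positivity), ← ENNReal.ofReal_mul (by positivity)]
      congr 1
      field_simp
    have e2 : P {ω | (θhat k ω, past k ω) ∈ M.atypical c L k} ≤ ENNReal.ofReal ((T ^ 2)⁻¹) := by
      have h := congrArg (fun μ => μ (M.atypical c L k))
        (hTP.map_sample_eq hdp k (measurable_history_pi k))
      rw [Measure.map_apply (hm2 k) (M.measurableSet_atypical c L k),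
        Measure.map_apply (hm1 k) (M.measurableSet_atypical c L k)] at h
      exact h.trans_le e1
    refine ENNReal.toReal_le_of_le_ofReal (by positivity) ?_
    refine (measure_union_le _ _).trans ((add_le_add e1 e2).trans (le_of_eq ?_))
    rw [← ENNReal.ofReal_add hε₀.le hε₀.le]
    congr 1
    ring
  set V : ℝ := M.pMax * (1 + M.H * d * dMax + 2 * (√(B * d) * √T)) with hV
  set D : ℝ := M.H * (M.pMax * dMax) with hD
  have hpath : ∀ᵐ ω ∂P, ∑ k ∈ Finset.range K,
      (M.value (θhat k ω) (dp (θhat k ω)) - M.value (θ ω) (dp (θhat k ω))) ≤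
      V + ∑ k ∈ Finset.range K, (bad k).indicator (fun _ => D) ω := by
    filter_upwards [ae_mem_support hTP.measurable_θ hTP.law_θ,
      ae_all_iff.2 fun k => ae_mem_support (hTP.measurable_θhat k) (hTP.law_sample hdp k)]
      with ω hω hωk
    have hgoodsum := sum_excess_le (G := M.demandClass) (K := K) (B := B) hB0 hdMax.le hε₀ hd
      (fun k h => (dp (θhat k ω) h, stateAt M.n (dp (θhat k ω)) h))
      (fun k => M.f (θhat k ω)) (fun _ => M.f (θ ω))
      ((Finset.range K).filter fun k => ω ∉ bad k) (Finset.filter_subset _ _)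
      (fun k _ => ⟨_, hωk k, rfl⟩) (fun k _ => ⟨_, hω, rfl⟩)
      (fun k hk => by
        obtain ⟨hkK, hkb⟩ := Finset.mem_filter.1 hk
        have hsq := M.sum_sq_le_of_notMem_atypical hbd hc hω (hωk k) (e := past k ω)
          (fun h => hkb (Or.inl h)) (fun h => hkb (Or.inr h)) hcs hε₀.le
        rw [Finset.sum_range]
        refine le_trans hsq (le_trans ?_ hB)
        have hkK' : (k : ℝ) * M.H ≤ T := by
          rw [hTdef, periods]
          have : (k : ℝ) ≤ K := by exact_mod_cast (Finset.mem_range.1 hkK).le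
          gcongr
        have : 4 * (T ^ 2)⁻¹ * dMax * (k * M.H) ≤ 4 * (T ^ 2)⁻¹ * dMax * T := by gcongr
        have h2 : 4 * (T ^ 2)⁻¹ * dMax * T = 4 * dMax / T := by field_simp
        linarith)
      (fun k _ h => by
        have b1 := hbd _ (hωk k) (dp (θhat k ω) h) (stateAt M.n (dp (θhat k ω)) h)
        have b2 := hbd _ hω (dp (θhat k ω) h) (stateAt M.n (dp (θhat k ω)) h)
        linarith [b1.2, b2.1])
    rw [← Finset.sum_filter_add_sum_filter_not (Finset.range K) fun k => ω ∉ bad k]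
    refine add_le_add ?_ ?_
    · calc _ ≤ ∑ k ∈ Finset.range K with ω ∉ bad k, M.pMax * ∑ h, max (M.demandParam (θhat k ω)
              (dp (θhat k ω)) h - M.demandParam (θ ω) (dp (θhat k ω)) h) 0 :=
            Finset.sum_le_sum fun k _ => M.value_sub_value_le _ _ _
        _ ≤ M.pMax * (K * M.H * (T ^ 2)⁻¹ + M.H * d * dMax + 2 * (√(B * d) * √(K * M.H))) := by
            rw [← Finset.mul_sum]
            exact mul_le_mul_of_nonneg_left hgoodsum M.pMax_nonneg
        _ ≤ V := by
            rw [hV, show (K : ℝ) * M.H = T from rfl]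
            have : T * (T ^ 2)⁻¹ ≤ 1 := by
              rw [← div_eq_mul_inv, div_le_one (by positivity)]
              nlinarith
            have := M.pMax_nonneg
            gcongr
    · rw [Finset.sum_filter]
      refine Finset.sum_le_sum fun k _ => ?_
      by_cases hk : ω ∈ bad k
      · rw [if_pos (by simpa using hk), Set.indicator_of_mem hk]
        linarith [(M.value_mem_Icc hbd (hωk k) (dp (θhat k ω))).2,
          (M.value_mem_Icc hbd hω (dp (θhat k ω))).1]
      · rw [if_neg (by simpa using hk), Set.indicator_of_notMem hk]
  have hD0 : 0 ≤ D := by have := M.pMax_nonneg; positivity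
  have hbadint : ∀ k ∈ Finset.range K, Integrable ((bad k).indicator fun _ : Ω => D) P :=
    fun k _ => (integrable_const D).indicator (hbadmeas k)
  rw [hTP.regret_eq hdp hbd]
  calc _ ≤ ∫ ω, (V + ∑ k ∈ Finset.range K, (bad k).indicator (fun _ => D) ω) ∂P :=
        integral_mono_ae (integrable_finsetSum _ fun k _ =>
          (hTP.integrable_value hbd (hTP.measurable_θhat k) (hdp.comp (hTP.measurable_θhat k))
            (hTP.law_sample hdp k)).sub
          (hTP.integrable_value hbd hTP.measurable_θ (hdp.comp (hTP.measurable_θhat k)) hTP.law_θ))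
          ((integrable_const V).add (integrable_finsetSum _ hbadint)) hpath
    _ = V + ∑ k ∈ Finset.range K, P.real (bad k) * D := by
        rw [integral_add (integrable_const V) (integrable_finsetSum _ hbadint),
          integral_finsetSum _ hbadint]
        simp only [integral_const, integral_indicator_const _ (hbadmeas _), probReal_univ,
          smul_eq_mul, one_mul]
    _ ≤ V + ∑ _k ∈ Finset.range K, 2 * (T ^ 2)⁻¹ * D := by
        gcongr with k
        exact hbadP k
    _ = V + 2 * M.pMax * dMax / T := by
        rw [Finset.sum_const, Finset.card_range, nsmul_eq_mul, hD]
        have : (K : ℝ) * (2 * (T ^ 2)⁻¹ * (M.H * (M.pMax * dMax))) =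
            2 * (T ^ 2)⁻¹ * (K * M.H) * (M.pMax * dMax) := by ring
        rw [this, show (K : ℝ) * M.H = T from rfl]
        field_simp

end IsThompsonPricing

/-! ### The bound with values in `[0, ∞]` -/

theorem demandClass_nonempty : M.demandClass.Nonempty := by
  have := M.isProbabilityMeasure_prior
  have h : M.prior.support ∈ ae M.prior := Measure.support_mem_ae
  exact (nonempty_of_mem h).image _

theorem beta_eq_ofReal {dMax : ℝ} (hdMax : 0 < dMax) {K N : ℕ} (hK : 1 ≤ K) (hN0 : N ≠ 0)
    (hN : supCoveringNumber M.demandClass ((M.periods K ^ 2)⁻¹) = N) :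
    M.beta dMax K = ENNReal.ofReal (8 * M.σ ^ 2 * Real.log (M.periods K ^ 2 * N) +
      2 / M.periods K * (8 * dMax + √(8 * M.σ ^ 2 * Real.log 4))) := by
  have hT := M.one_le_periods hK
  have hN1 : (1 : ℝ) ≤ N := by exact_mod_cast Nat.one_le_iff_ne_zero.2 hN0
  have hpos : 0 < M.periods K ^ 2 * N := by positivity
  have hlog : 0 ≤ Real.log (M.periods K ^ 2 * N) :=
    Real.log_nonneg (one_le_mul_of_one_le_of_one_le (one_le_pow₀ hT) hN1)
  rw [beta, hN, ENNReal.ofReal_add (by positivity) (by positivity),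
    ENNReal.ofReal_mul (p := 8 * M.σ ^ 2) (by positivity), ENat.toENNReal_coe,
    ← ENNReal.ofReal_natCast, ← ENNReal.ofReal_mul (by positivity),
    ENNReal.log_ofReal_of_pos hpos, EReal.real_coe_toENNReal]

theorem eluder_eq_natCast {K d : ℕ}
    (hd : eluderDim M.demandClass ((M.periods K ^ 2)⁻¹) = d) : M.eluder K = d := by
  rw [eluder, hd, ENat.toENNReal_coe]

theorem regretBound_eq_ofReal {dMax b : ℝ} (hdMax : 0 < dMax) (hb : 0 ≤ b) {K d : ℕ} (hK : 1 ≤ K)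
    (hβ : M.beta dMax K = ENNReal.ofReal b)
    (hd : eluderDim M.demandClass ((M.periods K ^ 2)⁻¹) = d) :
    M.regretBound dMax K = ENNReal.ofReal (M.pMax * (1 + M.H * dMax * d +
      4 * √(b * d * M.periods K)) + 4 * M.pMax * dMax / M.periods K) := by
  have hT := M.one_le_periods hK
  have hp := M.pMax_nonneg
  rw [regretBound, hβ, M.eluder_eq_natCast hd, Real.sqrt_eq_rpow,
    ENNReal.ofReal_add (by positivity) (by positivity), ENNReal.ofReal_mul hp,
    ENNReal.ofReal_add (by positivity) (by positivity),
    ENNReal.ofReal_add (by positivity) (by positivity), ENNReal.ofReal_one,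
    ENNReal.ofReal_mul (p := (M.H : ℝ) * dMax) (by positivity),
    ENNReal.ofReal_mul (p := (M.H : ℝ)) (by positivity),
    ENNReal.ofReal_mul (p := (4 : ℝ)) (by positivity),
    ← ENNReal.ofReal_rpow_of_nonneg (by positivity) (by positivity),
    ENNReal.ofReal_mul (p := b * d) (by positivity), ENNReal.ofReal_mul hb,
    ENNReal.ofReal_natCast, ENNReal.ofReal_natCast]
  norm_num

section

variable {M} {Ω : Type*} [MeasurableSpace Ω] {P : Measure Ω} {dp : M.Param → M.Policy}
  {θ : Ω → M.Param} {θhat : ℕ → Ω → M.Param} {y : ℕ → Fin M.H → Ω → ℝ} {dMax : ℝ}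

/-- The explicit bound in the case of finite complexities. The squared distance on the past is at
most `2 β`, as `N² (K H)² ≤ (N (K H)²)²`; the cruder bound `4 β` suffices for the constant `4` in
front of the square root. -/
theorem IsThompsonPricing.regret_le_of_eq (hTP : M.IsThompsonPricing dp θ θhat y P)
    (hdp : Measurable dp) (hbd : M.DemandBounded dMax) (hdMax : 0 < dMax) {K : ℕ} (hK : 1 ≤ K)
    {N d : ℕ} (hN0 : N ≠ 0)
    (hN : supCoveringNumber M.demandClass ((M.periods K ^ 2)⁻¹) = N)
    (hd : eluderDim M.demandClass ((M.periods K ^ 2)⁻¹) = d) {b : ℝ}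
    (hb : b = 8 * M.σ ^ 2 * Real.log (M.periods K ^ 2 * N) +
      2 / M.periods K * (8 * dMax + √(8 * M.σ ^ 2 * Real.log 4))) :
    0 ≤ b ∧ M.regret dp θ θhat P K ≤ M.pMax * (1 + M.H * dMax * d +
      4 * √(b * d * M.periods K)) + 4 * M.pMax * dMax / M.periods K := by
  have hT := M.one_le_periods hK
  have hN1 : (1 : ℝ) ≤ N := by exact_mod_cast Nat.one_le_iff_ne_zero.2 hN0
  have hp := M.pMax_nonneg
  set T := M.periods K with hTdef
  have hT0 : 0 < T := by linarith
  have hlogT := Real.log_nonneg hT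
  have hlogN := Real.log_nonneg hN1
  have hl1 : Real.log (T ^ 2 * N) = 2 * Real.log T + Real.log N := by
    rw [Real.log_mul (by positivity) (by positivity), Real.log_pow]; norm_num
  have hl2 : Real.log (N ^ 2 * T ^ 2) = 2 * Real.log N + 2 * Real.log T := by
    rw [Real.log_mul (by positivity) (by positivity), Real.log_pow, Real.log_pow]; norm_num
  have hσ2 : 0 < M.σ ^ 2 := pow_pos M.σ_pos 2
  have hb0 : 0 ≤ b := by rw [hb, hl1]; positivity
  refine ⟨hb0, (hTP.regret_le hdp hbd hdMax hK hN0 hN hd.le (B := 4 * b) ?_).trans ?_⟩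
  · rw [hb, hl1, hl2]
    have h1 : 2 / T * (8 * dMax + √(8 * M.σ ^ 2 * Real.log 4)) ≥ 4 * dMax / T := by
      rw [ge_iff_le, div_mul_eq_mul_div]
      refine div_le_div_of_nonneg_right ?_ hT0.le
      linarith [Real.sqrt_nonneg (8 * M.σ ^ 2 * Real.log 4)]
    have h2 : 0 ≤ 4 * dMax / T := by positivity
    nlinarith [mul_nonneg hσ2.le hlogT, mul_nonneg hσ2.le hlogN]
  · have h1 : √(4 * b * d) * √T = 2 * √(b * d * T) := by
      rw [← Real.sqrt_mul (by positivity), show 4 * b * d * T = 2 ^ 2 * (b * d * T) by ring,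
        Real.sqrt_mul (by positivity), Real.sqrt_sq (by norm_num)]
    have h2 : 2 * M.pMax * dMax / T ≤ 4 * M.pMax * dMax / T := by
      gcongr; norm_num
    rw [h1]
    refine add_le_add (le_of_eq ?_) h2
    ring

theorem IsThompsonPricing.ofReal_regret_le (hTP : M.IsThompsonPricing dp θ θhat y P)
    (hdp : Measurable dp) (hbd : M.DemandBounded dMax) (hdMax : 0 < dMax) {K : ℕ} (hK : 1 ≤ K) :
    ENNReal.ofReal (M.regret dp θ θhat P K) ≤ M.regretBound dMax K := by
  have hT := M.one_le_periods hK
  rcases M.pMax_nonneg.eq_or_lt with hp | hp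
  · have := hTP.regret_le_trivial hdp hbd K
    rw [← hp, zero_mul, zero_mul] at this
    rw [ENNReal.ofReal_of_nonpos this]
    exact zero_le
  have hp' : ENNReal.ofReal M.pMax ≠ 0 := by simpa using hp
  have hH : (M.H : ℝ≥0∞) ≠ 0 := by
    have := M.one_le_H
    exact_mod_cast (by omega : M.H ≠ 0)
  rcases eq_or_ne (eluderDim M.demandClass ((M.periods K ^ 2)⁻¹)) ⊤ with hd | hd
  · have : M.eluder K = ⊤ := by rw [eluder, hd, ENat.toENNReal_top]
    rw [regretBound, this, ENNReal.mul_top (mul_ne_zero hH (by simpa using hdMax))]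
    simp [ENNReal.mul_top hp']
  obtain ⟨d, hd⟩ := ENat.ne_top_iff_exists.1 hd
  rcases eq_or_ne (supCoveringNumber M.demandClass ((M.periods K ^ 2)⁻¹)) ⊤ with hN | hN
  · -- a class of eluder dimension `0` has covering number one, so the product is not `0 * ⊤`
    have hd0 : d ≠ 0 := by
      rintro rfl
      have := supCoveringNumber_le_one_of_eluderDim_eq_zero (by positivity) hd.symm
      rw [hN] at this
      exact absurd this (by simp)
    have hβ : M.beta dMax K = ⊤ := by
      rw [beta, hN, ENat.toENNReal_top,
        ENNReal.mul_top (by simpa using (zero_lt_one.trans_le hT).ne'),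
        ENNReal.log_top, EReal.toENNReal_top, ENNReal.mul_top (by simpa using M.σ_pos.ne'),
        top_add]
    rw [regretBound, hβ, M.eluder_eq_natCast hd.symm, ENNReal.top_mul (by exact_mod_cast hd0),
      ENNReal.top_mul (by simpa using zero_lt_one.trans_le hT),
      ENNReal.top_rpow_of_pos (by norm_num)]
    simp [ENNReal.mul_top hp', ENNReal.mul_top]
  obtain ⟨N, hN⟩ := ENat.ne_top_iff_exists.1 hN
  have hN0 : N ≠ 0 := by
    rintro rfl
    exact supCoveringNumber_ne_zero M.demandClass_nonempty hN.symm
  obtain ⟨hb, hle⟩ := hTP.regret_le_of_eq hdp hbd hdMax hK hN0 hN.symm hd.symm rfl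
  rw [M.regretBound_eq_ofReal hdMax hb hK (M.beta_eq_ofReal hdMax hK hN0 hN.symm) hd.symm]
  exact ENNReal.ofReal_le_ofReal hle

end

/-! ### The rate -/

theorem tendsto_periods : Tendsto M.periods atTop atTop := by
  have h : (0 : ℝ) < M.H := by exact_mod_cast M.one_le_H
  exact tendsto_natCast_atTop_atTop.atTop_mul_const h

theorem tendsto_inv_periods_sq :
    Tendsto (fun K => (M.periods K ^ 2)⁻¹) atTop (𝓝[>] (0 : ℝ)) :=
  tendsto_inv_atTop_nhdsGT_zero.comp
    ((tendsto_pow_atTop two_ne_zero).comp M.tendsto_periods)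

/-- A class of positive Kolmogorov dimension has positive eluder dimension at small scales. -/
theorem eventually_eluderDim_ne_zero (h : kolmogorovDim M.demandClass ≠ 0) :
    ∀ᶠ K in atTop, eluderDim M.demandClass ((M.periods K ^ 2)⁻¹) ≠ 0 := by
  by_contra hcon
  rw [not_eventually] at hcon
  simp only [not_not] at hcon
  refine h ?_
  have hzero : ∀ᶠ α : ℝ in 𝓝[>] 0, logCoveringNumber M.demandClass α /
      ENNReal.ofReal (Real.log (1 / α)) = 0 := by
    filter_upwards [self_mem_nhdsWithin] with α (hα : 0 < α)
    have hev : ∀ᶠ K in atTop, (M.periods K ^ 2)⁻¹ < α :=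
      M.tendsto_inv_periods_sq.eventually (mem_nhdsWithin_of_mem_nhds (Iio_mem_nhds hα))
    obtain ⟨K, hK0, hKα⟩ := (hcon.and_eventually hev).exists
    have hle := (supCoveringNumber_anti (G := M.demandClass) hKα.le).trans
      (supCoveringNumber_le_one_of_eluderDim_eq_zero (by positivity) hK0)
    have hle' : (supCoveringNumber M.demandClass α : ℝ≥0∞) ≤ 1 := by
      rw [← ENat.toENNReal_one]; exact ENat.toENNReal_le.2 hle
    rw [logCoveringNumber, EReal.toENNReal_of_nonpos (ENNReal.log_le_zero_iff.2 hle'),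
      ENNReal.zero_div]
  rw [kolmogorovDim, limsup_congr hzero]
  simp

theorem eventually_log_covering_le (h0 : kolmogorovDim M.demandClass ≠ 0)
    (htop : kolmogorovDim M.demandClass ≠ ⊤) :
    ∀ᶠ K in atTop, ∃ N : ℕ, N ≠ 0 ∧
      supCoveringNumber M.demandClass ((M.periods K ^ 2)⁻¹) = N ∧
      Real.log N ≤ 4 * (kolmogorovDim M.demandClass).toReal * Real.log (M.periods K) := by
  set D := kolmogorovDim M.demandClass with hD
  have hlt : limsup (fun α : ℝ => logCoveringNumber M.demandClass α /
      ENNReal.ofReal (Real.log (1 / α))) (𝓝[>] (0 : ℝ)) < 2 * D := by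
    rw [← kolmogorovDim, ← hD, two_mul]
    exact ENNReal.lt_add_right htop h0
  filter_upwards [M.tendsto_inv_periods_sq.eventually (eventually_lt_of_limsup_lt hlt),
    M.tendsto_periods.eventually_ge_atTop 2] with K hK hT
  have hlogT : 0 < Real.log (M.periods K) := Real.log_pos (by linarith)
  have hlog : Real.log (1 / (M.periods K ^ 2)⁻¹) = 2 * Real.log (M.periods K) := by
    rw [one_div, inv_inv, Real.log_pow]; norm_num
  rw [hlog] at hK
  have hle := (ENNReal.div_le_iff_le_mul (Or.inl (by simpa using hlogT))
    (Or.inl ENNReal.ofReal_ne_top)).1 hK.le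
  have hrhs : 2 * D * ENNReal.ofReal (2 * Real.log (M.periods K)) =
      ENNReal.ofReal (4 * D.toReal * Real.log (M.periods K)) := by
    conv_lhs => rw [← ENNReal.ofReal_toReal htop, ← ENNReal.ofReal_ofNat 2,
      ← ENNReal.ofReal_mul (by norm_num), ← ENNReal.ofReal_mul (by positivity)]
    congr 1
    ring
  rw [hrhs] at hle
  have hNtop : supCoveringNumber M.demandClass ((M.periods K ^ 2)⁻¹) ≠ ⊤ := by
    intro htop'
    rw [logCoveringNumber, htop', ENat.toENNReal_top, ENNReal.log_top, EReal.toENNReal_top] at hle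
    exact ENNReal.ofReal_ne_top (top_le_iff.1 hle)
  obtain ⟨N, hN⟩ := ENat.ne_top_iff_exists.1 hNtop
  have hN0 : N ≠ 0 := by
    rintro rfl
    exact supCoveringNumber_ne_zero M.demandClass_nonempty hN.symm
  refine ⟨N, hN0, hN.symm, ?_⟩
  have hNpos : (0 : ℝ) < N := by exact_mod_cast Nat.pos_of_ne_zero hN0
  rw [logCoveringNumber, ← hN, ENat.toENNReal_coe, ← ENNReal.ofReal_natCast,
    ENNReal.log_ofReal_of_pos hNpos, EReal.real_coe_toENNReal] at hle
  exact (ENNReal.ofReal_le_ofReal_iff (by positivity)).1 hle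

/-- Comparison of the explicit and the trivial bound with the rate. The term linear in `d` is below
the rate unless `d` is so large that the trivial bound is. -/
theorem min_bound_le_rate {R p σ H D d T b κ dMax : ℝ} (hp : 0 ≤ p) (hσ : 0 < σ) (hH : 0 < H)
    (hκ : 0 < κ) (hκD : κ ≤ D) (hd : 1 ≤ d) (hT : 2 ≤ T) (hdMax : 0 < dMax)
    (htriv : R ≤ p * dMax * T)
    (hR : R ≤ p * (1 + H * dMax * d + 4 * √(b * d * T)) + 4 * p * dMax / T)
    (hb : b ≤ (33 + 16 / κ) * (σ ^ 2 * D * Real.log T))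
    (h1 : (1 + 4 * dMax) ^ 2 ≤ σ ^ 2 * κ * (T * Real.log T))
    (h2 : H * dMax ^ 2 ≤ σ ^ 2 * κ * Real.log T) :
    R ≤ (2 + 4 * √(33 + 16 / κ)) * (p * σ * √(D * d * (T * Real.log T))) := by
  have hlog : 0 < Real.log T := Real.log_pos (by linarith)
  have hD : 0 < D := hκ.trans_le hκD
  have hT0 : 0 < T := by linarith
  have hd0 : 0 < d := by linarith
  set S := √(σ ^ 2 * (D * d * (T * Real.log T))) with hS
  have hS' : p * σ * √(D * d * (T * Real.log T)) = p * S := by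
    rw [hS, Real.sqrt_mul (sq_nonneg σ), Real.sqrt_sq hσ.le]; ring
  have hc : 0 ≤ √(33 + 16 / κ) := Real.sqrt_nonneg _
  have hS0 : 0 ≤ S := Real.sqrt_nonneg _
  rw [hS']
  rcases le_or_gt (d * (H * dMax) ^ 2) (σ ^ 2 * D * (T * Real.log T)) with hcase | hcase
  · have hA : 1 + 4 * dMax ≤ S := by
      refine Real.le_sqrt_of_sq_le (h1.trans ?_)
      have : κ ≤ D * d := by nlinarith
      calc σ ^ 2 * κ * (T * Real.log T) ≤ σ ^ 2 * (D * d) * (T * Real.log T) := by gcongr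
        _ = _ := by ring
    have hB : H * dMax * d ≤ S := by
      refine Real.le_sqrt_of_sq_le ?_
      calc (H * dMax * d) ^ 2 = d * (d * (H * dMax) ^ 2) := by ring
        _ ≤ d * (σ ^ 2 * D * (T * Real.log T)) := by gcongr
        _ = _ := by ring
    have hC : √(b * d * T) ≤ √(33 + 16 / κ) * S := by
      rw [hS, ← Real.sqrt_mul (by positivity)]
      refine Real.sqrt_le_sqrt ?_
      calc b * d * T ≤ (33 + 16 / κ) * (σ ^ 2 * D * Real.log T) * d * T := by gcongr
        _ = _ := by ring
    have hE : 4 * p * dMax / T ≤ p * (4 * dMax) := by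
      rw [div_le_iff₀ hT0]
      nlinarith [mul_nonneg hp hdMax.le]
    calc R ≤ p * (1 + H * dMax * d + 4 * √(b * d * T)) + p * (4 * dMax) := by linarith
      _ = p * ((1 + 4 * dMax) + H * dMax * d + 4 * √(b * d * T)) := by ring
      _ ≤ p * (S + S + 4 * (√(33 + 16 / κ) * S)) := by gcongr
      _ = _ := by ring
  · have hA : dMax * T ≤ S := by
      refine Real.le_sqrt_of_sq_le ?_
      set A := σ ^ 2 * D * (T * Real.log T) with hAdef
      have hA0 : 0 < A := by positivity
      have hAT : T * (H * dMax ^ 2) ≤ A := by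
        calc T * (H * dMax ^ 2) ≤ T * (σ ^ 2 * κ * Real.log T) := by gcongr
          _ ≤ T * (σ ^ 2 * D * Real.log T) := by gcongr
          _ = A := by rw [hAdef]; ring
      have hHd : 0 < (H * dMax) ^ 2 := by positivity
      refine le_of_mul_le_mul_right ?_ hHd
      calc (dMax * T) ^ 2 * (H * dMax) ^ 2 = (T * (H * dMax ^ 2)) ^ 2 := by ring
        _ ≤ A ^ 2 := by gcongr
        _ = A * A := sq A
        _ ≤ A * (d * (H * dMax) ^ 2) := by gcongr
        _ = _ := by rw [hAdef]; ring
    calc R ≤ p * (dMax * T) := by linarith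
      _ ≤ p * S := by gcongr
      _ ≤ _ := by nlinarith [mul_nonneg hp hS0, mul_nonneg hc (mul_nonneg hp hS0)]

theorem regretRate_eq_ofReal {K d : ℕ} (hT : 1 ≤ M.periods K)
    (htop : kolmogorovDim M.demandClass ≠ ⊤)
    (hd : eluderDim M.demandClass ((M.periods K ^ 2)⁻¹) = d) :
    M.regretRate K = ENNReal.ofReal (M.pMax * M.σ * √((kolmogorovDim M.demandClass).toReal * d *
      (M.periods K * Real.log (M.periods K)))) := by
  have hlog := Real.log_nonneg hT
  have hp := mul_nonneg M.pMax_nonneg M.σ_pos.le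
  rw [regretRate, M.eluder_eq_natCast hd, ENNReal.ofReal_mul hp, Real.sqrt_eq_rpow,
    ← ENNReal.ofReal_rpow_of_nonneg (by positivity) (by positivity),
    ENNReal.ofReal_mul (p := (kolmogorovDim M.demandClass).toReal * d) (by positivity),
    ENNReal.ofReal_mul (p := (kolmogorovDim M.demandClass).toReal) (by positivity),
    ENNReal.ofReal_toReal htop, ENNReal.ofReal_natCast]

theorem regretRate_eq_top {K : ℕ} (hp : 0 < M.pMax) (hT : 2 ≤ M.periods K)
    (h0 : kolmogorovDim M.demandClass ≠ 0)
    (hd0 : eluderDim M.demandClass ((M.periods K ^ 2)⁻¹) ≠ 0)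
    (h : kolmogorovDim M.demandClass = ⊤ ∨ eluderDim M.demandClass ((M.periods K ^ 2)⁻¹) = ⊤) :
    M.regretRate K = ⊤ := by
  have hlog : 0 < Real.log (M.periods K) := Real.log_pos (by linarith)
  have hTl : ENNReal.ofReal (M.periods K * Real.log (M.periods K)) ≠ 0 := by
    simpa using mul_pos (by linarith : 0 < M.periods K) hlog
  have he0 : M.eluder K ≠ 0 := by simpa [eluder] using hd0
  have hprod : kolmogorovDim M.demandClass * M.eluder K = ⊤ := by
    rcases h with h | h
    · rw [h, ENNReal.top_mul he0]
    · rw [eluder, h, ENat.toENNReal_top, ENNReal.mul_top h0]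
  rw [regretRate, hprod, ENNReal.top_mul hTl, ENNReal.top_rpow_of_pos (by norm_num),
    ENNReal.mul_top (by simpa using mul_pos hp M.σ_pos)]

theorem IsThompsonPricing.eventually_ofReal_regret_le {M : PricingModel} {Ω : Type*}
    [MeasurableSpace Ω] {P : Measure Ω} {dp : M.Param → M.Policy} {θ : Ω → M.Param}
    {θhat : ℕ → Ω → M.Param} {y : ℕ → Fin M.H → Ω → ℝ} {dMax : ℝ}
    (hTP : M.IsThompsonPricing dp θ θhat y P) (hdp : Measurable dp) (hbd : M.DemandBounded dMax)
    (hdMax : 0 < dMax) {κ : ℝ≥0} (hκ : 0 < κ) (hκD : (κ : ℝ≥0∞) ≤ kolmogorovDim M.demandClass) :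
    ∀ᶠ K : ℕ in atTop, ENNReal.ofReal (M.regret dp θ θhat P K) ≤
      (2 + 4 * NNReal.sqrt (33 + 16 / κ) : ℝ≥0) * M.regretRate K := by
  set C : ℝ≥0 := 2 + 4 * NNReal.sqrt (33 + 16 / κ) with hC
  have hC0 : (C : ℝ≥0∞) ≠ 0 := by
    have : C ≠ 0 := by positivity
    exact_mod_cast this
  have hκ' : (0 : ℝ) < κ := hκ
  have hD0 : kolmogorovDim M.demandClass ≠ 0 := by
    intro h
    rw [h] at hκD
    exact hκ.ne' (by simpa using hκD)
  rcases M.pMax_nonneg.eq_or_lt with hp | hp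
  · refine Eventually.of_forall fun K => ?_
    have := hTP.regret_le_trivial hdp hbd K
    rw [← hp, zero_mul, zero_mul] at this
    rw [ENNReal.ofReal_of_nonpos this]
    exact zero_le
  have hT2 := M.tendsto_periods.eventually_ge_atTop 2
  have hd0 := M.eventually_eluderDim_ne_zero hD0
  by_cases htop : kolmogorovDim M.demandClass = ⊤
  · filter_upwards [hT2, hd0] with K hT hd
    rw [M.regretRate_eq_top hp hT hD0 hd (Or.inl htop), ENNReal.mul_top hC0]
    exact le_top
  have hσ := M.σ_pos
  have hH : (0 : ℝ) < M.H := by exact_mod_cast M.one_le_H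
  have hlogtop : Tendsto (fun K => M.σ ^ 2 * κ * Real.log (M.periods K)) atTop atTop :=
    (Real.tendsto_log_atTop.comp M.tendsto_periods).const_mul_atTop (by positivity)
  filter_upwards [hT2, hd0, M.eventually_log_covering_le hD0 htop, eventually_ge_atTop 1,
    hlogtop.eventually_ge_atTop ((1 + 4 * dMax) ^ 2), hlogtop.eventually_ge_atTop (M.H * dMax ^ 2),
    hlogtop.eventually_ge_atTop (2 * (8 * dMax + √(8 * M.σ ^ 2 * Real.log 4)))]
    with K hT hd ⟨N, hN0, hN, hlogN⟩ hK h1 h2 h3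
  rcases eq_or_ne (eluderDim M.demandClass ((M.periods K ^ 2)⁻¹)) ⊤ with hdtop | hdtop
  · rw [M.regretRate_eq_top hp hT hD0 hd (Or.inr hdtop), ENNReal.mul_top hC0]
    exact le_top
  obtain ⟨d, hd'⟩ := ENat.ne_top_iff_exists.1 hdtop
  have hd1 : (1 : ℝ) ≤ d := by
    rw [← hd'] at hd
    exact_mod_cast Nat.one_le_iff_ne_zero.2 (by exact_mod_cast hd)
  obtain ⟨-, hle⟩ := hTP.regret_le_of_eq hdp hbd hdMax hK hN0 hN hd'.symm rfl
  rw [M.regretRate_eq_ofReal (by linarith) htop hd'.symm, ← ENNReal.ofReal_coe_nnreal,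
    ← ENNReal.ofReal_mul C.coe_nonneg]
  refine ENNReal.ofReal_le_ofReal ?_
  set D := (kolmogorovDim M.demandClass).toReal with hD
  have hκD' : (κ : ℝ) ≤ D := by
    have := ENNReal.toReal_mono htop hκD
    simpa using this
  have hCr : (C : ℝ) = 2 + 4 * √(33 + 16 / (κ : ℝ)) := by
    rw [hC]; push_cast; rfl
  rw [hCr]
  set T := M.periods K with hTdef
  have hlog : 0 < Real.log T := Real.log_pos (by linarith)
  have hT0 : 0 < T := by linarith
  have hNpos : (0 : ℝ) < N := by exact_mod_cast Nat.pos_of_ne_zero hN0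
  refine min_bound_le_rate hp.le hσ hH hκ' hκD' hd1 hT hdMax
    (hTP.regret_le_trivial hdp hbd K) hle ?_ ?_ h2
  · -- `16 σ² log T`, `8 σ² log N` and the remaining term of `β` are at most `16 / κ`, `32` and `1`
    -- times `σ² d_K log T`
    have hl1 : Real.log (T ^ 2 * N) = 2 * Real.log T + Real.log N := by
      rw [Real.log_mul (by positivity) (by positivity), Real.log_pow]; norm_num
    have hs : 2 / T * (8 * dMax + √(8 * M.σ ^ 2 * Real.log 4)) ≤ M.σ ^ 2 * D * Real.log T := by
      calc 2 / T * (8 * dMax + √(8 * M.σ ^ 2 * Real.log 4))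
          = 2 * (8 * dMax + √(8 * M.σ ^ 2 * Real.log 4)) / T := by ring
        _ ≤ 2 * (8 * dMax + √(8 * M.σ ^ 2 * Real.log 4)) :=
            div_le_self (by positivity) (by linarith)
        _ ≤ M.σ ^ 2 * κ * Real.log T := h3
        _ ≤ M.σ ^ 2 * D * Real.log T := by gcongr
    have hk : 16 * Real.log T ≤ 16 / κ * (D * Real.log T) := by
      rw [div_mul_eq_mul_div, le_div_iff₀ hκ']
      nlinarith [mul_le_mul_of_nonneg_right hκD' hlog.le]
    rw [hl1]
    have h5 : 8 * M.σ ^ 2 * (2 * Real.log T + Real.log N) ≤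
        M.σ ^ 2 * (16 / κ * (D * Real.log T) + 32 * (D * Real.log T)) := by
      have : 0 < M.σ ^ 2 := by positivity
      rw [mul_comm (8 : ℝ), mul_assoc]
      gcongr
      linarith
    calc _ ≤ M.σ ^ 2 * (16 / κ * (D * Real.log T) + 32 * (D * Real.log T)) +
          M.σ ^ 2 * D * Real.log T := add_le_add h5 hs
      _ = _ := by ring
  · refine h1.trans ?_
    have : Real.log T ≤ T * Real.log T := by nlinarith
    gcongr

end PricingModel

theorem theorem1 :
    -- the explicit bound, for every number `K ≥ 1` of episodes
    (∀ (M : PricingModel) (dMax : ℝ), 0 < dMax → M.DemandBounded dMax →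
      ∀ dp : M.Param → M.Policy, M.IsPlanner dp →
      ∀ (Ω : Type*) [MeasurableSpace Ω] (P : Measure Ω) (θ : Ω → M.Param)
        (θhat : ℕ → Ω → M.Param) (y : ℕ → Fin M.H → Ω → ℝ),
      M.IsThompsonPricing dp θ θhat y P →
      ∀ K : ℕ, 1 ≤ K →
        Integrable (M.loss dp θ θhat K) P ∧
        ENNReal.ofReal (M.regret dp θ θhat P K) ≤ M.regretBound dMax K) ∧
    -- the rate as `K → ∞`; the constant depends only on a positive lower bound of `d_K(F)`
    (∀ κ : ℝ≥0, 0 < κ → ∃ C : ℝ≥0,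
      ∀ (M : PricingModel) (dMax : ℝ), 0 < dMax → M.DemandBounded dMax →
      (κ : ℝ≥0∞) ≤ kolmogorovDim M.demandClass →
      ∀ dp : M.Param → M.Policy, M.IsPlanner dp →
      ∀ (Ω : Type*) [MeasurableSpace Ω] (P : Measure Ω) (θ : Ω → M.Param)
        (θhat : ℕ → Ω → M.Param) (y : ℕ → Fin M.H → Ω → ℝ),
      M.IsThompsonPricing dp θ θhat y P →
      ∀ᶠ K : ℕ in atTop,
        ENNReal.ofReal (M.regret dp θ θhat P K) ≤ C * M.regretRate K) := by
  refine ⟨fun M dMax hdMax hbd dp hdp Ω _ P θ θhat y hTP K hK =>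
    ⟨hTP.integrable_loss hdp.measurable hbd K, hTP.ofReal_regret_le hdp.measurable hbd hdMax hK⟩,
    fun κ hκ => ⟨2 + 4 * NNReal.sqrt (33 + 16 / κ),
      fun M dMax hdMax hbd hκD dp hdp Ω _ P θ θhat y hTP =>
        hTP.eventually_ofReal_regret_le hdp.measurable hbd hdMax hκ hκD⟩⟩
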